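/- **Conventions.** Permutations are written in one-line notation. $\mathcal{A}=\operatorname{Av}(4231, 35142, 42513, 351624)$ is the set of permutations that contain none of these four patterns. A permutation is *simple* if the only non-empty intervals of its domain that it maps to intervals are the singletons and the whole domain. **The crenellation form.** Let $m\ge 1$. The figure with $m$ blocks consists of $m+3$ *isolated points* $p_0,\dots,p_{m+2}$ and of $m$ *blocks* $B_0,\dots,B_{m-1}$, each made of three *segments* $B_t^0,B_t^1,B_t^2$; the block $B_t$ is *$N$-shaped* if $t$ is even and *$S$-shaped* if $t$ is odd. Each piece of the figure lies in a (column, row), as follows: - $p_i$ lies in $(4i-6,\,4i-2)$ if $i$ is even, and in $(4i,\,4i-8)$ if $i$ is odd; - $B_t^s$ lies in $(4t+1+2s,\;4t+1)$ if $t$ is even, and in $(4t+3,\;4t-1+2s)$ if $t$ is odd. So the three segments of an $N$-shaped block lie side by side in a common row, and those of an $S$-shaped block lie on top of each other in a common column; no other two pieces share a row or a column. A permutation $\pi$ has the *crenellation form* if for some $m\ge 1$ the entries $(x,\pi(x))$ can be distributed over the pieces of the figure with $m$ blocks in such a way that 1. every isolated point carries exactly one entry (a segment may carry any number of entries, including none);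 2. if $x<y$, then the column of the piece of $x$ is at most that of the piece of $y$; if $\pi(x)<\pi(y)$, then the row of the piece of $x$ is at most that of the piece of $y$; 3. the entries on each of the segments $B_t^0$ and $B_t^2$ are increasing, and those on each $B_t^1$ are decreasing. **Theorem.** Every simple permutation $\pi\in\mathcal{A}$ of length at least $4$ with $\pi(2)\ne 1$ has the crenellation form. Conversely, every simple permutation of the crenellation form lies in $\mathcal{A}$. -/

import Mathlib

namespace SchubertSimple

/-- `Contains w π`: the pattern `w`, given in one-line notation, occurs in `π`, i.e. some
subsequence `π (f 0), π (f 1), …` of `π` is in the same relative order as `w`. -/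
def Contains {k n : ℕ} (w : Fin k → ℕ) (π : Equiv.Perm (Fin n)) : Prop :=
  ∃ f : Fin k → Fin n, StrictMono f ∧ ∀ i j, w i < w j ↔ π (f i) < π (f j)

/-- Membership in the class `𝒜 = Av(4231, 35142, 42513, 351624)`. -/
def InClassA {n : ℕ} (π : Equiv.Perm (Fin n)) : Prop :=
  ¬ Contains ![4, 2, 3, 1] π ∧ ¬ Contains ![3, 5, 1, 4, 2] π ∧
    ¬ Contains ![4, 2, 5, 1, 3] π ∧ ¬ Contains ![3, 5, 1, 6, 2, 4] π

/-- A permutation is simple if the only intervals which it maps to intervals are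
the singletons (or the empty interval) and its entire domain. -/
def IsSimple {n : ℕ} (π : Equiv.Perm (Fin n)) : Prop :=
  ∀ I : Set (Fin n), I.OrdConnected → (π '' I).OrdConnected → I.Subsingleton ∨ I = Set.univ

/-- The pieces of the figure with `m` blocks: its `m + 3` isolated points, and the three
monotone line segments `0, 1, 2` of each of the `m` blocks. Blocks `0, 2, 4, …` are `N`-shaped
and their segments are numbered from left to right; blocks `1, 3, 5, …` are `S`-shaped and their
segments are numbered from bottom to top. -/
inductive Piece (m : ℕ) : Type
  | isolated (i : Fin (m + 3)) : Piece m
  | segment (t : Fin m) (s : Fin 3) : Piece m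

/-- The horizontal place of a piece. Two pieces share a column only when they are
segments of the same `S`-shaped block. -/
def Piece.col {m : ℕ} : Piece m → ℤ
  | .isolated i => if Even i.val then 4 * (i.val : ℤ) - 6 else 4 * (i.val : ℤ)
  | .segment t s => if Even t.val then 4 * (t.val : ℤ) + 1 + 2 * (s.val : ℤ)
      else 4 * (t.val : ℤ) + 3

/-- The vertical place of a piece. Two pieces share a row only when they are
segments of the same `N`-shaped block. -/
def Piece.row {m : ℕ} : Piece m → ℤ
  | .isolated i => if Even i.val then 4 * (i.val : ℤ) - 2 else 4 * (i.val : ℤ) - 8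
  | .segment t s => if Even t.val then 4 * (t.val : ℤ) + 1
      else 4 * (t.val : ℤ) - 1 + 2 * (s.val : ℤ)

/-- `π` can be drawn on the figure with `m` blocks: its entries are distributed over the
pieces so that each isolated point is used exactly once, entries in different columns
(rows) are ordered as the columns (rows) are, and the entries on a single segment are increasing,
or decreasing for the middle segment of a block. Segments may carry any number of entries,
and the entries of a block may interleave in any way that these conditions leave open. -/
structure IsDrawing {n m : ℕ} (π : Equiv.Perm (Fin n)) (piece : Fin n → Piece m) : Prop where
  isolated_present : ∀ i : Fin (m + 3), ∃! x : Fin n, piece x = .isolated i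
  col_le : ∀ x y : Fin n, x < y → (piece x).col ≤ (piece y).col
  row_le : ∀ x y : Fin n, π x < π y → (piece x).row ≤ (piece y).row
  increasing : ∀ (t : Fin m) (s : Fin 3), s ≠ 1 → ∀ x y : Fin n,
    piece x = .segment t s → piece y = .segment t s → x < y → π x < π y
  decreasing : ∀ (t : Fin m) (x y : Fin n),
    piece x = .segment t 1 → piece y = .segment t 1 → x < y → π y < π x

/-- `π` has the crenellation form: it can be drawn on the figure with some positive
number of blocks. -/
def HasCrenellationForm {n : ℕ} (π : Equiv.Perm (Fin n)) : Prop :=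
  ∃ m : ℕ, 1 ≤ m ∧ ∃ piece : Fin n → Piece m, IsDrawing π piece

end SchubertSimple

/-! Start at the leftmost entry and alternately pass to the rightmost entry below, and the topmost
entry to the left of, the entry just reached. This zigzag ends by repeating two entries, and
simplicity forces them to be the top and rightmost ones (`Chain.top`). Its members are the isolated
points; the other entries lie in cells between them.

One argument recurs. If a region were not as claimed, it would contain a non-trivial interval unless
some outside entry cut it, and that entry together with the zigzag forms a forbidden pattern. Hence
certain strips are empty (`not_below_between`), and the near part of every cell is increasing
(`increasing_below_left`). The far part is decreasing because a rise in it would complete 4231. An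
increasing part is shared between two consecutive blocks: the entries cut by the preceding block
belong to that block. No entry is cut from both sides (`not_cut_twice`), so the two shares are
separated.

At the start only one entry lies below the leftmost one (`eq_of_below_leftmost`); this is where π(2)
≠ 1 enters. The other end follows by a half-turn. The class is also closed under inverses, so with
alternating coordinates all steps of the zigzag are the same step.

For the converse, an inversion spans few columns, so an occurrence of a forbidden pattern fits into
a bounded window of a periodic figure, and a finite check excludes it. -/

namespace SchubertSimple

/-! ### Simple point sets in the plane and their symmetries -/

/-- A configuration of points with coordinates `X` and `Y` that is simple and avoids
`4231`, `35142`, `42513` and `351624`. -/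
structure PlaneSimple {α : Type*} (X Y : α → ℤ) : Prop where
  injX : ∀ a b, X a = X b → a = b
  injY : ∀ a b, Y a = Y b → a = b
  simple : ∀ S : Set α, (∀ a ∈ S, ∀ b ∈ S, ∀ c, X a < X c → X c < X b → c ∈ S) →
    (∀ a ∈ S, ∀ b ∈ S, ∀ c, Y a < Y c → Y c < Y b → c ∈ S) → S.Subsingleton ∨ S = Set.univ
  av4231 : ∀ a b c d, X a < X b → X b < X c → X c < X d →
    Y d < Y b → Y b < Y c → Y c < Y a → False
  av35142 : ∀ a b c d e, X a < X b → X b < X c → X c < X d → X d < X e →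
    Y c < Y e → Y e < Y a → Y a < Y d → Y d < Y b → False
  av42513 : ∀ a b c d e, X a < X b → X b < X c → X c < X d → X d < X e →
    Y d < Y b → Y b < Y e → Y e < Y a → Y a < Y c → False
  av351624 : ∀ a b c d e f, X a < X b → X b < X c → X c < X d → X d < X e → X e < X f →
    Y c < Y e → Y e < Y a → Y a < Y f → Y f < Y b → Y b < Y d → False

namespace PlaneSimple

variable {α : Type*} {X Y : α → ℤ}

theorem swap (C : PlaneSimple X Y) : PlaneSimple Y X where
  injX := C.injY
  injY := C.injX
  simple S h1 h2 := C.simple S h2 h1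
  av4231 a b c d h1 h2 h3 g1 g2 g3 := C.av4231 d b c a g1 g2 g3 h1 h2 h3
  av35142 a b c d e h1 h2 h3 h4 g1 g2 g3 g4 := C.av35142 c e a d b g1 g2 g3 g4 h1 h2 h3 h4
  av42513 a b c d e h1 h2 h3 h4 g1 g2 g3 g4 := C.av42513 d b e a c g1 g2 g3 g4 h1 h2 h3 h4
  av351624 a b c d e f h1 h2 h3 h4 h5 g1 g2 g3 g4 g5 :=
    C.av351624 c e a f b d g1 g2 g3 g4 g5 h1 h2 h3 h4 h5

theorem neg (C : PlaneSimple X Y) : PlaneSimple (-X) (-Y) where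
  injX a b h := C.injX a b (neg_injective h)
  injY a b h := C.injY a b (neg_injective h)
  simple S h1 h2 := C.simple S
    (fun a ha b hb c h h' => h1 b hb a ha c (neg_lt_neg h') (neg_lt_neg h))
    (fun a ha b hb c h h' => h2 b hb a ha c (neg_lt_neg h') (neg_lt_neg h))
  av4231 a b c d := by
    simp only [Pi.neg_apply, neg_lt_neg_iff]
    intro h1 h2 h3 h4 h5 h6
    apply C.av4231 d c b a <;> assumption
  av35142 a b c d e := by
    simp only [Pi.neg_apply, neg_lt_neg_iff]
    intro h1 h2 h3 h4 h5 h6 h7 h8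
    apply C.av42513 e d c b a <;> assumption
  av42513 a b c d e := by
    simp only [Pi.neg_apply, neg_lt_neg_iff]
    intro h1 h2 h3 h4 h5 h6 h7 h8
    apply C.av35142 e d c b a <;> assumption
  av351624 a b c d e f := by
    simp only [Pi.neg_apply, neg_lt_neg_iff]
    intro h1 h2 h3 h4 h5 h6 h7 h8 h9 h10
    apply C.av351624 f e d c b a <;> assumption

theorem X_ne (C : PlaneSimple X Y) {a b : α} (h : Y a ≠ Y b) : X a ≠ X b :=
  fun h' => h (by rw [C.injX a b h'])

theorem Y_ne (C : PlaneSimple X Y) {a b : α} (h : X a ≠ X b) : Y a ≠ Y b :=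
  fun h' => h (by rw [C.injY a b h'])

/-- Nothing below `p` lies between `s` and `r`. -/
theorem not_below_between (C : PlaneSimple X Y) {p r s : α} (hrp : Y r < Y p)
    (hr : ∀ x, Y x < Y p → X x ≤ X r) (hsr : X s < X r) (hps : Y p < Y s)
    (hs : ∀ x, X x < X r → Y x ≤ Y s) (hpsX : X p < X s)
    (hq : ∀ z, X z < X p → ∃ q, X p < X q ∧ X q < X s ∧ ∀ e, X q < X e → Y q < Y e)
    {e : α} (h1 : X s < X e) (h2 : X e < X r) : Y p ≤ Y e := by
  by_contra h3
  push Not at h3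
  -- The quadrant right of `s` and below `p` contains `e` and `r` but not `p`, so it is not an
  -- interval; every entry that could cut it completes a forbidden pattern.
  refine (C.simple {x | X s < X x ∧ Y x < Y p} ?_ ?_).elim (fun h => ?_) (fun h => ?_)
  rotate_left 2
  · have := h (show e ∈ _ from ⟨h1, h3⟩) (show r ∈ _ from ⟨hsr, hrp⟩)
    subst this; omega
  · have : p ∈ {x | X s < X x ∧ Y x < Y p} := h ▸ Set.mem_univ p
    exact absurd this.2 (lt_irrefl _)
  · rintro a ⟨ha1, ha2⟩ b ⟨hb1, hb2⟩ c hac hcb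
    refine ⟨by omega, ?_⟩
    by_contra hc
    have hbr := hr b hb2
    have hcp : Y c ≠ Y p := C.Y_ne (by omega)
    have hcs : Y c ≠ Y s := C.Y_ne (by omega)
    have hcs' := hs c (by omega)
    have har : Y a ≠ Y r := C.Y_ne (by omega)
    rcases lt_or_gt_of_ne har with h | h
    · exact C.av35142 p s a c r hpsX (by omega) (by omega) (by omega) (by omega) (by omega)
        (by omega) (by omega)
    · exact C.av4231 s a c r (by omega) (by omega) (by omega) (by omega) (by omega) (by omega)
  · rintro a ⟨ha1, ha2⟩ b ⟨hb1, hb2⟩ c hac hcb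
    refine ⟨?_, by omega⟩
    by_contra hc
    have hcs : X c ≠ X s := C.X_ne (by omega)
    have hcp : X c ≠ X p := C.X_ne (by omega)
    have hab : X a ≠ X b := C.X_ne (by omega)
    rcases lt_or_gt_of_ne hcp with h | h
    · obtain ⟨q, hq1, hq2, hq3⟩ := hq c h
      have := hq3 a (by omega)
      have := hq3 b (by omega)
      rcases lt_or_gt_of_ne hab with h' | h'
      · exact C.av351624 c p q s a b (by omega) (by omega) (by omega) (by omega) (by omega)
          (by omega) (by omega) (by omega) (by omega) (by omega)
      · exact C.av35142 c p q b a (by omega) (by omega) (by omega) (by omega) (by omega)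
          (by omega) (by omega) (by omega)
    · rcases lt_or_gt_of_ne hab with h' | h'
      · exact C.av42513 p c s a b (by omega) (by omega) (by omega) (by omega) (by omega)
          (by omega) (by omega) (by omega)
      · exact C.av4231 p c b a (by omega) (by omega) (by omega) (by omega) (by omega) (by omega)

/-- The inversion relation restricted to `S`. -/
def Inv (X Y : α → ℤ) (S : Set α) (a b : α) : Prop :=
  a ∈ S ∧ b ∈ S ∧ (X a < X b ∧ Y b < Y a ∨ X b < X a ∧ Y a < Y b)

theorem Inv.comm {S : Set α} {a b : α} : Inv X Y S a b ↔ Inv Y X S a b := by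
  unfold Inv; tauto

/-- An edge of the inversion graph cannot jump over `c`: by `hX` the point `c` would lie in `S` and
form an inversion with one end of the edge, hence belong to the component. So a component is an
interval of the `X`-order. -/
theorem component_side {S : Set α} (injX : ∀ a b, X a = X b → a = b)
    (injY : ∀ a b, Y a = Y b → a = b)
    (hX : ∀ a ∈ S, ∀ b ∈ S, X a < X b → Y b < Y a → ∀ c, X a < X c → X c < X b → c ∈ S)
    {e c x : α} (hc : ¬ Relation.ReflTransGen (Inv X Y S) e c)
    (hx : Relation.ReflTransGen (Inv X Y S) e x) : X x < X c ↔ X e < X c := by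
  induction hx with
  | refl => rfl
  | @tail y z hy hyz ih =>
    rw [← ih]
    have hcy : X c ≠ X y := fun h => hc (injX _ _ h ▸ hy)
    have hcz : X c ≠ X z := fun h => hc (injX _ _ h ▸ hy.tail hyz)
    have hcy' : Y c ≠ Y y := fun h => hc (injY _ _ h ▸ hy)
    have hRy : ¬ Inv X Y S y c := fun h => hc (hy.tail h)
    have hRz : ¬ Inv X Y S z c := fun h => hc ((hy.tail hyz).tail h)
    obtain ⟨hyS, hzS, h | h⟩ := hyz
    · constructor
      · intro; omega
      · intro hyc
        by_contra hzc
        have hcS := hX y hyS z hzS h.1 h.2 c hyc (by omega)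
        by_cases h' : Y c < Y y
        · exact hRy ⟨hyS, hcS, Or.inl ⟨hyc, h'⟩⟩
        · exact hRz ⟨hzS, hcS, Or.inr ⟨by omega, by omega⟩⟩
    · constructor
      · intro hzc
        by_contra hyc
        have hcS := hX z hzS y hyS h.1 h.2 c hzc (by omega)
        by_cases h' : Y c < Y y
        · exact hRz ⟨hzS, hcS, Or.inl ⟨hzc, by omega⟩⟩
        · exact hRy ⟨hyS, hcS, Or.inr ⟨by omega, by omega⟩⟩
      · intro; omega

/-- A proper set of points whose inversions are not cut from outside is increasing. -/
theorem increasing_of_uncut (C : PlaneSimple X Y) {S : Set α} {r : α} (hr : r ∉ S)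
    (hX : ∀ a ∈ S, ∀ b ∈ S, X a < X b → Y b < Y a → ∀ c, X a < X c → X c < X b → c ∈ S)
    (hY : ∀ a ∈ S, ∀ b ∈ S, X a < X b → Y b < Y a → ∀ c, Y b < Y c → Y c < Y a → c ∈ S)
    {a b : α} (ha : a ∈ S) (hb : b ∈ S) (hab : X a < X b) : Y a < Y b := by
  by_contra hba
  have hne : Y a ≠ Y b := C.Y_ne (by omega)
  have hinv : Inv X Y S a b := ⟨ha, hb, Or.inl ⟨hab, by omega⟩⟩
  have hY' : ∀ a ∈ S, ∀ b ∈ S, Y a < Y b → X b < X a → ∀ c, Y a < Y c → Y c < Y b → c ∈ S :=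
    fun a ha b hb h h' => hY b hb a ha h' h
  have hIJ : Inv Y X S = Inv X Y S := by ext; exact Inv.comm
  -- The component of `a` in the inversion graph is an interval in both coordinates; it contains `a`
  -- and `b` and misses `r`.
  refine (C.simple {x | Relation.ReflTransGen (Inv X Y S) a x} ?_ ?_).elim (fun h => ?_) (fun h => ?_)
  rotate_left 2
  · have := h (show a ∈ _ from Relation.ReflTransGen.refl)
      (show b ∈ _ from Relation.ReflTransGen.single hinv)
    subst this; omega
  · have : Relation.ReflTransGen (Inv X Y S) a r := by
      have : r ∈ {x | Relation.ReflTransGen (Inv X Y S) a x} := h ▸ Set.mem_univ r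
      exact this
    rcases Relation.ReflTransGen.cases_tail this with h' | ⟨y, -, h'⟩
    · exact hr (h' ▸ ha)
    · exact hr h'.2.1
  · intro x hx y hy c hxc hcy
    by_contra hc
    have h1 := component_side C.injX C.injY hX hc hx
    have h2 := component_side C.injX C.injY hX hc hy
    omega
  · intro x hx y hy c hxc hcy
    by_contra hc
    simp only [Set.mem_ofPred_eq, ← hIJ] at hx hy hc
    have h1 := component_side C.injY C.injX hY' hc hx
    have h2 := component_side C.injY C.injX hY' hc hy
    omega

/-- The points right of `b`, left of `r` and below `r` are increasing. -/
theorem increasing_below_left (C : PlaneSimple X Y) {p r : α} {b : ℤ} (hrp : Y r < Y p)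
    (hr : ∀ x, Y x < Y p → X x ≤ X r) (hpb : X p ≤ b)
    (hq : ∀ z, X z < X p → ∃ q, X p < X q ∧ X q ≤ b ∧ ∀ e, b < X e → Y q < Y e)
    {x y : α} (hx : b < X x ∧ X x < X r ∧ Y x < Y r) (hy : b < X y ∧ X y < X r ∧ Y y < Y r)
    (hxy : X x < X y) : Y x < Y y := by
  refine C.increasing_of_uncut (S := {x | b < X x ∧ X x < X r ∧ Y x < Y r}) (r := r)
    (fun h => absurd h.2.1 (lt_irrefl _)) ?_ ?_ hx hy hxy
  · rintro e ⟨he1, he2, he3⟩ e' ⟨he1', he2', he3'⟩ hee hee' v hv hv'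
    refine ⟨by omega, by omega, ?_⟩
    by_contra h
    have hvr : Y v ≠ Y r := C.Y_ne (by omega)
    have hvp : Y v ≠ Y p := C.Y_ne (by omega)
    rcases lt_or_gt_of_ne hvp with h' | h'
    · exact C.av4231 p e v e' (by omega) (by omega) (by omega) (by omega) (by omega) (by omega)
    · exact C.av42513 p e v e' r (by omega) (by omega) (by omega) (by omega) (by omega) (by omega)
        (by omega) (by omega)
  · rintro e ⟨he1, he2, he3⟩ e' ⟨he1', he2', he3'⟩ hee hee' u hu hu'
    have hur : X u ≠ X r := C.X_ne (by omega)
    have hup : X u ≠ X p := C.X_ne (by omega)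
    have hue : X u ≠ X e := C.X_ne (by omega)
    have hue' : X u ≠ X e' := C.X_ne (by omega)
    by_cases hub : b < X u
    · refine ⟨hub, ?_, by omega⟩
      have := hr u (by omega)
      omega
    exfalso
    rcases lt_or_gt_of_ne hup with h' | h'
    · obtain ⟨q, hq1, hq2, hq3⟩ := hq u h'
      have := hq3 e' he1'
      exact C.av35142 u p q e e' (by omega) (by omega) (by omega) (by omega) (by omega) (by omega)
        (by omega) (by omega)
    · exact C.av4231 p u e e' (by omega) (by omega) (by omega) (by omega) (by omega) (by omega)

/-- A point of the increasing cell is not cut both from the left and from above. -/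
theorem not_cut_twice (C : PlaneSimple X Y) {q p r e u v : α} (hpq : X p < X q) (hrp : Y r < Y p)
    (hqe : Y q < Y e) (her : X e < X r) (hu : X u < X q) (heu : Y e < Y u) (hur : Y u < Y r)
    (hqv : X q < X v) (hve : X v < X e) (hrv : Y r < Y v) : False := by
  have hup : X u ≠ X p := C.X_ne (by omega)
  have hvp : Y v ≠ Y p := C.Y_ne (by omega)
  rcases lt_or_gt_of_ne hup with h | h <;> rcases lt_or_gt_of_ne hvp with h' | h'
  · exact C.av35142 u p q v e (by omega) (by omega) (by omega) (by omega) (by omega) (by omega)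
      (by omega) (by omega)
  · exact C.av351624 u p q v e r (by omega) (by omega) (by omega) (by omega) (by omega) (by omega)
      (by omega) (by omega) (by omega) (by omega)
  · exact C.av4231 p u v e (by omega) (by omega) (by omega) (by omega) (by omega) (by omega)
  · exact C.av42513 p u v e r (by omega) (by omega) (by omega) (by omega) (by omega) (by omega)
      (by omega) (by omega)

/-- Only `r` lies below the leftmost point `p`. -/
theorem eq_of_below_leftmost [Finite α] (C : PlaneSimple X Y) {p r s : α} (hp : ∀ x, X p ≤ X x)
    (hrp : Y r < Y p) (hr : ∀ x, Y x < Y p → X x ≤ X r) (hsr : X s < X r) (hps : Y p < Y s)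
    (hs : ∀ x, X x < X r → Y x ≤ Y s)
    (hA : ∀ e, X s < X e → X e < X r → Y p ≤ Y e)
    (hsec : ∀ e, e ≠ p → (∀ x, x ≠ p → X e ≤ X x) → ∃ x, Y x < Y e)
    {x : α} (hx : Y x < Y p) : x = r := by
  have hp' : ∀ x, x ≠ p → X p < X x := fun x hx =>
    lt_of_le_of_ne (hp x) fun h => hx (C.injX _ _ h.symm)
  have hne : ∀ {x}, Y x ≠ Y p → X p < X x := fun {x} h => hp' x (by rintro rfl; exact h rfl)
  -- If this fails, the points left of the leftmost offender `e` form an interval, hence only `p` is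
  -- left of `e`.
  have key : ∀ x, x ≠ p → X x < X r → Y r < Y x := by
    by_contra hcon
    push Not at hcon
    obtain ⟨x0, h1, h2, h3⟩ := hcon
    obtain ⟨e, ⟨he1, he2, he3⟩, hemin⟩ := Set.exists_min_image
      {x | X p < X x ∧ X x < X r ∧ Y x < Y r} X (Set.toFinite _)
      ⟨x0, hp' _ h1, h2, lt_of_le_of_ne h3 (C.Y_ne (by omega))⟩
    have hes : X e < X s := by
      have := C.X_ne (a := e) (b := s) (by omega)
      have := hA e
      omega
    have hK : ∀ x, X x < X e → Y r < Y x := by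
      intro x hx
      by_cases hxp : x = p
      · subst hxp; exact hrp
      · by_contra h
        have := C.Y_ne (a := x) (b := r) (by omega)
        have := hemin x ⟨hp' _ hxp, by omega, by omega⟩
        omega
    refine (C.simple {x | X x < X e} ?_ ?_).elim (fun h => ?_) (fun h => ?_)
    rotate_left 2
    · have hp1 : ∀ x, x ≠ p → X e ≤ X x := by
        intro x hx
        by_contra hlt
        exact hx (h (show x ∈ _ from (by simpa using hlt)) (show p ∈ _ from he1))
      -- Now `e` is second from the left. The point below it that `hsec` provides lies in the
      -- increasing region to the right of `e`, which is absurd.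
      obtain ⟨x, hx⟩ := hsec e (by rintro rfl; omega) hp1
      have hxr := C.X_ne (a := x) (b := r) (by omega)
      have hxe := C.X_ne (a := x) (b := e) (by omega)
      have h1 := hr x (by omega)
      have h2 : X p < X x := hne (by omega)
      have h3 := hemin x ⟨h2, by omega, by omega⟩
      have := C.increasing_below_left (p := p) (r := r) (b := X p) hrp hr le_rfl
        (fun z hz => absurd (hp z) (by omega)) ⟨he1, he2, he3⟩ ⟨h2, by omega, by omega⟩
        (by omega : X e < X x)
      omega
    · have : e ∈ {x | X x < X e} := h ▸ Set.mem_univ e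
      exact absurd this (lt_irrefl (X e))
    · intro a _ b hb c _ hcb
      exact hcb.trans hb
    · intro a ha b hb c hac hcb
      by_contra hc
      simp only [Set.mem_ofPred_eq, not_lt] at ha hb hc
      have hra := hK a ha
      have hce := C.X_ne (a := c) (b := e) (by omega)
      have hcr := C.X_ne (a := c) (b := r) (by omega)
      have hcp : Y c ≠ Y p := C.Y_ne (by omega)
      rcases lt_or_gt_of_ne hcp with h | h
      · have := hr c h
        have : X p < X a := hne (by omega)
        exact C.av4231 p a c r (by omega) (by omega) (by omega) (by omega) (by omega) (by omega)
      · have : X p < X b := hne (by omega)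
        have := hs b (by omega)
        have := C.Y_ne (a := b) (b := s) (by omega)
        rcases lt_or_gt_of_ne hcr with h' | h'
        · exact C.av35142 p b e c r (by omega) (by omega) (by omega) (by omega) (by omega)
            (by omega) (by omega) (by omega)
        · exact C.av351624 p b e s r c (by omega) (by omega) (by omega) (by omega) (by omega)
            (by omega) (by omega) (by omega) (by omega) (by omega)
  by_contra hxr
  have hxr' : X x ≠ X r := fun h => hxr (C.injX _ _ h)
  have hxr2 := hr x hx
  have hxp : x ≠ p := by rintro rfl; omega
  obtain ⟨e, ⟨he1, he2⟩, hemax⟩ := Set.exists_max_image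
    {x | Y r < Y x ∧ Y x < Y p} X (Set.toFinite _) ⟨x, key x hxp (by omega), hx⟩
  have her : X e < X r := lt_of_le_of_ne (hr e he2) (C.X_ne (by omega))
  have hep : X p < X e := hne (by omega)
  have hes : X e < X s := by
    have := C.X_ne (a := e) (b := s) (by omega)
    have := hA e
    omega
  -- With `e` the rightmost point between the heights of `r` and `p`, everything up to `e` is an
  -- interval containing `p` and `e` but not `r`.
  refine (C.simple {x | X x ≤ X e} ?_ ?_).elim (fun h => ?_) (fun h => ?_)
  rotate_left 2
  · have := h (show p ∈ _ from hep.le) (show e ∈ _ from le_refl (X e))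
    subst this; omega
  · have : r ∈ {x | X x ≤ X e} := h ▸ Set.mem_univ r
    simp only [Set.mem_ofPred_eq] at this
    omega
  · intro a _ b hb c _ hcb
    exact hcb.le.trans hb
  · intro a ha b hb c hac hcb
    by_contra hc
    simp only [Set.mem_ofPred_eq, not_le] at ha hb hc
    have hra : Y r < Y a := by
      by_cases hap : a = p
      · subst hap; exact hrp
      · exact key a hap (by omega)
    have hcp : Y c ≠ Y p := C.Y_ne (by omega)
    have hcr := C.X_ne (a := c) (b := r) (by omega)
    rcases lt_or_gt_of_ne hcp with h | h
    · have := hemax c ⟨by omega, h⟩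
      omega
    · have hbe := C.X_ne (a := b) (b := e) (by omega)
      have := hs b (by omega)
      have := C.Y_ne (a := b) (b := s) (by omega)
      rcases lt_or_gt_of_ne hcr with h' | h'
      · exact C.av4231 b e c r (by omega) (by omega) (by omega) (by omega) (by omega) (by omega)
      · exact C.av42513 b e s r c (by omega) (by omega) (by omega) (by omega) (by omega)
          (by omega) (by omega) (by omega)

/-- In a simple configuration of at least three points, deleting one point does not leave an
interval. -/
theorem not_corner (C : PlaneSimple X Y) {p a b : α} (hab : a ≠ b) (hap : a ≠ p) (hbp : b ≠ p)
    (hX : (∀ x, X p ≤ X x) ∨ ∀ x, X x ≤ X p) (hY : (∀ x, Y p ≤ Y x) ∨ ∀ x, Y x ≤ Y p) : False := by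
  have aux : ∀ {W : α → ℤ}, ((∀ x, W p ≤ W x) ∨ ∀ x, W x ≤ W p) →
      ∀ a ∈ {x | x ≠ p}, ∀ b ∈ {x | x ≠ p}, ∀ c, W a < W c → W c < W b → c ∈ {x | x ≠ p} := by
    rintro W hW a - b - c h1 h2 rfl
    rcases hW with h | h
    · have := h a; omega
    · have := h b; omega
  rcases C.simple {x | x ≠ p} (aux hX) (aux hY) with h | h
  · exact hab (h hap hbp)
  · exact (h ▸ Set.mem_univ p : p ∈ {x | x ≠ p}) rfl

end PlaneSimple
-- Alternating coordinates and the zigzag of isolated points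
/-- `X` at even indices and `Y` at odd ones. -/
def coord {α : Type*} (X Y : α → ℤ) : ℕ → α → ℤ
  | 0 => X
  | 1 => Y
  | n + 2 => coord X Y n

theorem PlaneSimple.coord {α : Type*} {X Y : α → ℤ} (C : PlaneSimple X Y) :
    ∀ i, PlaneSimple (coord X Y i) (coord X Y (i + 1))
  | 0 => C
  | i + 1 => (PlaneSimple.coord C i).swap

/-- The sequence of isolated points: `p 0` is the leftmost point and `p 1`, `p 2`, … are
alternately the rightmost point below and the topmost point to the left of the preceding one,
until `p k` and `p (k + 1)` start to repeat. -/
structure Chain {α : Type*} (X Y : α → ℤ) (p : ℕ → α) (k : ℕ) : Prop where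
  plane : PlaneSimple X Y
  left : ∀ x, coord X Y 0 (p 0) ≤ coord X Y 0 x
  lt : ∀ i, coord X Y (i + 1) (p (i + 1)) < coord X Y (i + 1) (p i)
  max : ∀ i x, coord X Y (i + 1) x < coord X Y (i + 1) (p i) →
    coord X Y i x ≤ coord X Y i (p (i + 1))
  step : ∀ j < k, p (j + 2) ≠ p j
  fixed : p (k + 2) = p k

namespace Chain

variable {α : Type*} {X Y : α → ℤ} {p : ℕ → α} {k : ℕ}

local notation "Z" => coord X Y

theorem inj (H : Chain X Y p k) (i : ℕ) {a b : α} (h : Z i a = Z i b) : a = b :=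
  (H.plane.coord i).injX a b h

theorem ne (H : Chain X Y p k) (i j : ℕ) {a b : α} (h : Z i a ≠ Z i b) : Z j a ≠ Z j b :=
  fun h' => h (by rw [H.inj j h'])

theorem lt' (H : Chain X Y p k) (i : ℕ) : Z i (p (i + 2)) < Z i (p (i + 1)) := H.lt (i + 1)

theorem max' (H : Chain X Y p k) (i : ℕ) (x : α) (h : Z i x < Z i (p (i + 1))) :
    Z (i + 1) x ≤ Z (i + 1) (p (i + 2)) := H.max (i + 1) x h

/-- Inductively, `p i` is a candidate in the maximum that defines `p (i + 2)`. -/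
theorem self_lt_succ (H : Chain X Y p k) : ∀ i, Z i (p i) < Z i (p (i + 1))
  | 0 => lt_of_le_of_ne (H.left _) (H.ne 1 0 (H.lt 0).ne')
  | i + 1 => (H.lt i).trans_le (H.max' i (p i) (H.self_lt_succ i))

theorem le_add_two (H : Chain X Y p k) (i : ℕ) : Z (i + 1) (p i) ≤ Z (i + 1) (p (i + 2)) :=
  H.max' i (p i) (H.self_lt_succ i)

theorem lt_add_two (H : Chain X Y p k) {i : ℕ} (hi : i < k) :
    Z (i + 1) (p i) < Z (i + 1) (p (i + 2)) :=
  lt_of_le_of_ne (H.le_add_two i) fun h => H.step i hi (H.inj _ h.symm)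

theorem lt_add_three (H : Chain X Y p k) {j : ℕ} (hj : j + 1 < k) :
    Z (j + 1) (p j) < Z (j + 1) (p (j + 3)) := by
  have h1 := H.self_lt_succ j
  have h2 : Z j (p (j + 1)) < Z j (p (j + 3)) := H.lt_add_two hj
  have h3 := H.max j (p (j + 3))
  have h4 := H.ne j (j + 1) (a := p j) (b := p (j + 3)) (by omega)
  omega

theorem self_lt_add_two (H : Chain X Y p k) : ∀ {i : ℕ}, i < k → Z i (p i) < Z i (p (i + 2))
  | 0, hi => lt_of_le_of_ne (H.left _) (H.ne 1 0 (H.lt_add_two hi).ne)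
  | j + 1, hi => (H.lt j).trans (H.lt_add_three hi)

theorem lt_of_lt (H : Chain X Y p k) {j : ℕ} {x : α} (hx : Z (j + 1) (p j) < Z (j + 1) x) :
    Z j (p j) < Z j x := by
  cases j with
  | zero => exact lt_of_le_of_ne (H.left _) (H.ne 1 0 hx.ne)
  | succ j =>
    by_contra h
    have h1 := H.lt j
    have h2 := H.max j x (by omega)
    have h3 : Z j (p (j + 1)) < Z j x := hx
    omega

/-- The predecessor of `p i` serves as the auxiliary point `q`; for `i = 0` nothing lies to the left
and none is needed. -/
theorem not_below_between (H : Chain X Y p k) {i : ℕ} (hi : i < k) {e : α}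
    (h1 : Z i (p (i + 2)) < Z i e) (h2 : Z i e < Z i (p (i + 1))) :
    Z (i + 1) (p i) ≤ Z (i + 1) e := by
  refine (H.plane.coord i).not_below_between (H.lt i) (H.max i) (H.lt' i) (H.lt_add_two hi)
    (H.max' i) (H.self_lt_add_two hi) ?_ h1 h2
  intro z hz
  cases i with
  | zero => exact absurd (H.left z) (not_le.2 hz)
  | succ j => exact ⟨p j, H.lt j, H.lt_add_three hi, fun e he => H.lt_of_lt he⟩

theorem increasing (H : Chain X Y p k) {t : ℕ} {x y : α}
    (hx : Z (t + 1) (p t) < Z (t + 1) x) (hx' : Z (t + 1) x < Z (t + 1) (p (t + 2)))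
    (hx'' : Z t x < Z t (p (t + 2)))
    (hy : Z (t + 1) (p t) < Z (t + 1) y) (hy' : Z (t + 1) y < Z (t + 1) (p (t + 2)))
    (hy'' : Z t y < Z t (p (t + 2))) (hxy : Z (t + 1) x < Z (t + 1) y) : Z t x < Z t y :=
  (H.plane.coord (t + 1)).increasing_below_left (H.lt (t + 1)) (H.max (t + 1)) (H.lt t).le
    (fun _ _ => ⟨p t, H.lt t, le_rfl, fun _ he => H.lt_of_lt he⟩)
    ⟨hx, hx', hx''⟩ ⟨hy, hy', hy''⟩ hxy

/-- Because `p (k + 2) = p k`, the two bounds are equivalent for every point. Their common lower set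
is an interval in both coordinates containing `p k` and `p (k + 1)`, so it is everything. -/
theorem top (H : Chain X Y p k) (x : α) :
    Z k x ≤ Z k (p (k + 1)) ∧ Z (k + 1) x ≤ Z (k + 1) (p k) := by
  have key : ∀ x, Z k x ≤ Z k (p (k + 1)) ↔ Z (k + 1) x ≤ Z (k + 1) (p k) := by
    intro x
    have h1 := H.max k x
    have h2 := H.max' k x
    have h3 := H.self_lt_succ k
    have h4 := H.lt k
    rw [H.fixed] at h2
    constructor
    · intro h
      rcases h.lt_or_eq with h | h
      · exact h2 h
      · rw [H.inj _ h]; exact h4.le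
    · intro h
      rcases h.lt_or_eq with h | h
      · exact h1 h
      · rw [H.inj _ h]; exact h3.le
  have hS := (H.plane.coord k).simple {x | Z k x ≤ Z k (p (k + 1))}
    (fun a _ b hb c _ hcb => hcb.le.trans hb)
    (fun a _ b hb c _ hcb => (key c).2 (hcb.le.trans ((key b).1 hb)))
  rcases hS with h | h
  · have h1 := H.lt k
    rw [h (show p k ∈ _ from (H.self_lt_succ k).le) (show p (k + 1) ∈ _ from le_refl (Z k _))] at h1
    exact absurd h1 (lt_irrefl _)
  · have : x ∈ {x | Z k x ≤ Z k (p (k + 1))} := h ▸ Set.mem_univ x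
    exact ⟨this, (key x).1 this⟩

theorem pos_of_three (H : Chain X Y p k) (h3 : ∀ c : α, ∃ a b, a ≠ b ∧ a ≠ c ∧ b ≠ c) :
    0 < k := by
  rw [Nat.pos_iff_ne_zero]
  rintro rfl
  obtain ⟨a, b, hab, ha, hb⟩ := h3 (p 0)
  exact H.plane.not_corner hab ha hb (Or.inl H.left) (Or.inr fun x => (H.top x).2)

theorem initial [Finite α] (H : Chain X Y p k) (hk : 0 < k)
    (hsec : ∀ e, e ≠ p 0 → (∀ x, x ≠ p 0 → X e ≤ X x) → ∃ x, Y x < Y e)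
    {x : α} (hx : Z 1 x < Z 1 (p 0)) : x = p 1 :=
  H.plane.eq_of_below_leftmost H.left (H.lt 0) (H.max 0) (H.lt' 0) (H.lt_add_two hk) (H.max' 0)
    (fun _ => H.not_below_between hk) hsec hx

/-- For `k = 1` the point `p 1` would be both rightmost and lowest, a corner. -/
theorem one_lt [Finite α] (H : Chain X Y p k) (h3 : ∀ c : α, ∃ a b, a ≠ b ∧ a ≠ c ∧ b ≠ c)
    (hsec : ∀ e, e ≠ p 0 → (∀ x, x ≠ p 0 → X e ≤ X x) → ∃ x, Y x < Y e) : 1 < k := by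
  have hk := H.pos_of_three h3
  by_contra h
  obtain rfl : k = 1 := by omega
  obtain ⟨a, b, hab, ha, hb⟩ := h3 (p 1)
  refine H.plane.not_corner hab ha hb (Or.inr fun x => (H.top x).2) (Or.inl fun x => ?_)
  by_contra hx
  have h1 := H.lt 0
  have h2 : Z 1 x < Z 1 (p 1) := not_le.1 hx
  rw [H.initial hk hsec (h2.trans h1)] at h2
  exact absurd h2 (lt_irrefl _)

/-- The half-turn of `initial`: the zigzag read backwards from `p (k + 1)`. The analogue of π(2) ≠ 1
comes for free, since `p (k - 1)` lies strictly between `p k` and `p (k + 1)` in coordinate `k`. -/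
theorem final [Finite α] (H : Chain X Y p k) (hk : 1 < k)
    {x : α} (hx : Z (k + 1) (p (k + 1)) < Z (k + 1) x) : x = p k := by
  obtain ⟨j, rfl⟩ : ∃ j, k = j + 2 := ⟨k - 2, by omega⟩
  have hA1 := fun e => H.not_below_between (i := j) (e := e) (by omega)
  have hA2 := fun e => H.not_below_between (i := j + 1) (e := e) (by omega)
  have hA2' : ∀ e, Z (j + 1) (p (j + 3)) < Z (j + 1) e → Z (j + 1) e < Z (j + 1) (p (j + 2)) →
    Z j (p (j + 1)) ≤ Z j e := hA2
  have ht : ∀ x, Z j x ≤ Z j (p (j + 3)) := fun x => (H.top x).1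
  have ht' : ∀ x, Z (j + 1) x ≤ Z (j + 1) (p (j + 2)) := fun x => (H.top x).2
  have e1 : Z j (p (j + 1)) < Z j (p (j + 3)) := H.lt_add_two (i := j + 1) (by omega)
  have e2 := H.lt' j
  have e3 : Z (j + 1) (p (j + 1)) < Z (j + 1) (p (j + 3)) := H.self_lt_add_two (by omega)
  have e4 : Z (j + 1) (p (j + 3)) < Z (j + 1) (p (j + 2)) := H.lt (j + 2)
  have e5 := H.lt j
  refine (H.plane.coord j).neg.eq_of_below_leftmost (p := p (j + 3)) (r := p (j + 2))
    (s := p (j + 1)) ?_ (neg_lt_neg e4) ?_ (neg_lt_neg e2) (neg_lt_neg e3) ?_ ?_ ?_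
    (neg_lt_neg hx)
  · exact fun x => neg_le_neg (ht x)
  · intro x hx
    have hx := neg_lt_neg_iff.1 hx
    apply neg_le_neg
    by_contra h
    have h1 := hA2' x hx (lt_of_le_of_ne (ht' x) (H.ne j (j + 1) (by omega)))
    omega
  · intro x hx
    have hx := neg_lt_neg_iff.1 hx
    apply neg_le_neg
    by_contra h
    have h1 := hA1 x hx
    have h2 := H.max j x (by omega)
    have h3 := H.ne (j + 1) j (a := x) (b := p (j + 1)) (by omega)
    omega
  · intro x h1 h2
    have h1 := neg_lt_neg_iff.1 h1
    have h2 := neg_lt_neg_iff.1 h2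
    apply neg_le_neg
    by_contra h
    have h3 := hA2' x (by omega) (lt_of_le_of_ne (ht' x) (H.ne j (j + 1) (by omega)))
    omega
  · intro x hx hx'
    by_cases h : x = p (j + 2)
    · subst h
      have := hx' (p (j + 1)) (by intro h; rw [h] at e1; omega)
      simp only [Pi.neg_apply] at this
      omega
    · exact ⟨p (j + 2), neg_lt_neg (lt_of_le_of_ne (ht' x) fun h' => h (H.inj _ h'))⟩

end Chain

/-! ### Existence of the zigzag -/

/-- The rightmost point below `a`, if there is one. -/
noncomputable def next {α : Type*} (X Y : α → ℤ) (a : α) : α :=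
  open Classical in
  if h : ∃ b, Y b < Y a ∧ ∀ x, Y x < Y a → X x ≤ X b then h.choose else a

theorem next_spec {α : Type*} [Finite α] {X Y : α → ℤ} {a b : α} (h : Y b < Y a) :
    Y (next X Y a) < Y a ∧ ∀ x, Y x < Y a → X x ≤ X (next X Y a) := by
  have h' : ∃ b, Y b < Y a ∧ ∀ x, Y x < Y a → X x ≤ X b := by
    obtain ⟨c, hc, hc'⟩ := Set.exists_max_image {x | Y x < Y a} X (Set.toFinite _) ⟨b, h⟩
    exact ⟨c, hc, hc'⟩
  rw [next, dif_pos h']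
  exact h'.choose_spec

/-- The sequence of isolated points starting at `a`. -/
noncomputable def chainSeq {α : Type*} (X Y : α → ℤ) (a : α) : ℕ → α
  | 0 => a
  | i + 1 => next (coord X Y i) (coord X Y (i + 1)) (chainSeq X Y a i)

theorem exists_chain {α : Type*} [Finite α] {X Y : α → ℤ} (C : PlaneSimple X Y) {a b : α}
    (ha : ∀ x, X a ≤ X x) (hb : Y b < Y a) : ∃ k, Chain X Y (chainSeq X Y a) k := by
  have key : ∀ i, coord X Y i (chainSeq X Y a i) < coord X Y i (chainSeq X Y a (i + 1)) ∧
      coord X Y (i + 1) (chainSeq X Y a (i + 1)) < coord X Y (i + 1) (chainSeq X Y a i) ∧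
      ∀ x, coord X Y (i + 1) x < coord X Y (i + 1) (chainSeq X Y a i) →
        coord X Y i x ≤ coord X Y i (chainSeq X Y a (i + 1)) := by
    intro i
    induction i with
    | zero =>
      have h := next_spec (X := X) hb
      exact ⟨lt_of_le_of_ne (ha _) (C.X_ne h.1.ne'), h⟩
    | succ i ih =>
      have h := next_spec (X := coord X Y (i + 1)) (Y := coord X Y i) ih.1
      exact ⟨ih.2.1.trans_le (h.2 _ ih.1), h⟩
  have hex : ∃ k, chainSeq X Y a (k + 2) = chainSeq X Y a k := by
    by_contra hcon
    push Not at hcon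
    have hlt : ∀ i, coord X Y (i + 1) (chainSeq X Y a i) <
        coord X Y (i + 1) (chainSeq X Y a (i + 2)) := fun i =>
      lt_of_le_of_ne ((key (i + 1)).2.2 _ (key i).1)
        fun h => hcon i ((C.coord (i + 1)).injX _ _ h.symm)
    -- Without repetition the points of even index would climb in `Y` forever.
    have hmono : StrictMono fun i => Y (chainSeq X Y a (2 * i)) := by
      refine strictMono_nat_of_lt_succ fun i => ?_
      have h : ∀ i, coord X Y (2 * i + 1) = Y := by
        intro i
        induction i with
        | zero => rfl
        | succ i ih => exact ih
      have := hlt (2 * i)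
      rwa [h] at this
    exact not_injective_infinite_finite (fun i => chainSeq X Y a (2 * i))
      fun i j hij => hmono.injective (congrArg Y hij)
  open Classical in
  exact ⟨Nat.find hex, C, ha, fun i => (key i).2.1, fun i => (key i).2.2,
    fun j hj => Nat.find_min hex hj, Nat.find_spec hex⟩
-- Distributing the remaining points over the segments
namespace Chain

variable {α : Type*} {X Y : α → ℤ} {p : ℕ → α} {k : ℕ}

local notation "Z" => coord X Y

variable (X Y p) in
/-- The region between consecutive isolated points that holds the points of block `t`
that lie beside `p (t + 1)`. -/
structure Cell (t : ℕ) (x : α) : Prop where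
  left : Z (t + 1) (p t) < Z (t + 1) x
  right : Z (t + 1) x < Z (t + 1) (p (t + 2))
  below : Z t x < Z t (p (t + 1))

variable (X Y p) in
/-- The point `x` is cut by a point of the preceding block. -/
def Early (t : ℕ) (x : α) : Prop :=
  ∃ u, Z (t + 1) u < Z (t + 1) (p t) ∧ Z t x < Z t u ∧ Z t u < Z t (p (t + 2))

theorem Cell.lower (H : Chain X Y p k) {t : ℕ} {x : α} (hx : Cell X Y p (t + 1) x) :
    Z (t + 1) (p t) < Z (t + 1) x := by
  have h1 : Z t (p (t + 1)) < Z t x := hx.left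
  have h2 := H.max t x
  have h3 := H.self_lt_succ t
  have h4 := H.ne t (t + 1) (a := p t) (b := x) (by omega)
  omega

theorem Cell.lower_zero (H : Chain X Y p k) {x : α} (hx : Cell X Y p 0 x) :
    Z 0 (p 0) < Z 0 x :=
  lt_of_le_of_ne (H.left x) (H.ne 1 0 hx.left.ne)

/-- A point beyond `p (t + 3)` would lie in the strip emptied by `not_below_between`. -/
theorem Cell.lt_add_three (H : Chain X Y p k) {t : ℕ} (ht : t + 1 < k) {x : α}
    (hx : Cell X Y p t x) : Z (t + 1) x < Z (t + 1) (p (t + 3)) := by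
  have h1 : Z (t + 1) (p (t + 3)) < Z (t + 1) x → Z (t + 1) x < Z (t + 1) (p (t + 2)) →
    Z t (p (t + 1)) ≤ Z t x := fun h h' => H.not_below_between ht h h'
  have h2 := hx.right
  have h3 := hx.below
  have h4 : Z t (p (t + 1)) < Z t (p (t + 3)) := H.lt_add_two ht
  have h5 := H.ne t (t + 1) (a := x) (b := p (t + 3)) (by omega)
  omega

/-- Otherwise `x` itself would be the cutting point that makes `y` early. -/
theorem Cell.lt_of_not_early (H : Chain X Y p k) {t : ℕ} (ht : t + 1 < k) {x y : α}
    (hx : Cell X Y p t x) (hy : Cell X Y p (t + 1) y) (hy' : ¬ Early X Y p (t + 1) y) :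
    Z (t + 1) x < Z (t + 1) y := by
  have h1 : Z t (p (t + 1)) < Z t y := hy.left
  have h2 := hx.below
  have h3 := H.ne t (t + 1) (a := x) (b := y) (by omega)
  by_contra h
  exact hy' ⟨x, h2, by omega, hx.lt_add_three H ht⟩

theorem Early.lt_of_not_early {t : ℕ} {x y : α} (hx : Early X Y p t x)
    (hy : ¬ Early X Y p t y) : Z t x < Z t y := by
  by_contra h
  obtain ⟨u, h1, h2, h3⟩ := hx
  exact hy ⟨u, h1, by omega, h3⟩

theorem Early.lt_of_cut (H : Chain X Y p k) {t : ℕ} {x v : α} (hx : Cell X Y p t x)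
    (hx' : Z t x < Z t (p (t + 2))) (hE : Early X Y p t x)
    (hv : Z (t + 1) (p t) < Z (t + 1) v) (hv' : Z t (p (t + 2)) < Z t v) :
    Z (t + 1) x < Z (t + 1) v := by
  by_contra h
  obtain ⟨u, h1, h2, h3⟩ := hE
  have h4 := H.ne t (t + 1) (a := x) (b := v) (by omega)
  exact (H.plane.coord (t + 1)).not_cut_twice (H.lt t) (H.lt' t) (H.lt_of_lt hx.left) hx.right h1 h2
    h3 hv (by omega) hv'

theorem Early.lt_of_not_early' (H : Chain X Y p k) {t : ℕ} {x y : α} (hx : Cell X Y p t x)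
    (hx' : Z t x < Z t (p (t + 2))) (hE : Early X Y p t x) (hy : Cell X Y p t y)
    (hE' : ¬ Early X Y p t y) : Z (t + 1) x < Z (t + 1) y := by
  have h1 := hE.lt_of_not_early hE'
  have h2 := H.ne t (t + 1) (a := x) (b := y) (by omega)
  by_contra h
  by_cases h3 : Z t y < Z t (p (t + 2))
  · have := H.increasing hy.left hy.right h3 hx.left hx.right hx' (by omega)
    omega
  · have h4 : Z t y ≠ Z t (p (t + 2)) := H.ne (t + 1) t hy.right.ne
    exact h (Early.lt_of_cut H hx hx' hE hy.left (by omega))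

theorem not_early_zero (H : Chain X Y p k)
    (hI : ∀ x, Z 1 x < Z 1 (p 0) → x = p 1) {x : α} : ¬ Early X Y p 0 x := by
  rintro ⟨u, h1, -, h2⟩
  rw [hI u h1] at h2
  exact lt_asymm h2 (H.lt' 0)

/-- The last cell holds no points of a block beyond the last one. -/
theorem early_last (H : Chain X Y p (k + 1)) (hF : ∀ x, Z (k + 2) (p (k + 2)) < Z (k + 2) x →
      x = p (k + 1)) {x : α} (hx : Cell X Y p k x) (hx' : Z k x < Z k (p (k + 2))) :
    Early X Y p k x := by
  by_contra hE
  have hF : ∀ x, Z k (p (k + 2)) < Z k x → x = p (k + 1) := hF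
  have ht : ∀ x, Z (k + 1) x ≤ Z (k + 1) (p (k + 2)) := fun x => (H.top x).1
  have h1 := H.lt k
  have h2 := hx.left
  have hcell : ∀ y, y ≠ p (k + 1) → Z k y ≤ Z k (p (k + 2)) :=
    fun y hy => not_lt.1 fun h => hy (hF y h)
  -- The points from `x` onwards include the extreme point `p (k + 2)` and omit `p (k + 1)`. A point
  -- cutting this set would break monotonicity of the cell or witness that `x` is early.
  refine ((H.plane.coord (k + 1)).simple {y | Z (k + 1) x ≤ Z (k + 1) y}
    (fun a ha b _ c hac _ => le_trans (show Z (k + 1) x ≤ Z (k + 1) a from ha) hac.le) ?_).elim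
    (fun h => ?_) (fun h => ?_)
  rotate_left
  · have := h (show x ∈ _ from le_refl (Z (k + 1) x)) (show p (k + 2) ∈ _ from ht x)
    rw [this] at hx'
    exact lt_irrefl _ hx'
  · have : p (k + 1) ∈ {y | Z (k + 1) x ≤ Z (k + 1) y} := h ▸ Set.mem_univ _
    have : Z (k + 1) x ≤ Z (k + 1) (p (k + 1)) := this
    omega
  · intro a ha b hb c hac hcb
    have ha : Z (k + 1) x ≤ Z (k + 1) a := ha
    have hb : Z (k + 1) x ≤ Z (k + 1) b := hb
    have hac : Z k a < Z k c := hac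
    have hcb : Z k c < Z k b := hcb
    by_contra hc
    have hc : Z (k + 1) c < Z (k + 1) x := not_le.1 hc
    have hb2 := hcell b (by rintro rfl; omega)
    have hxa : Z k x ≤ Z k a := by
      by_contra hlt
      have e1 := H.ne k (k + 1) (a := x) (b := a) (by omega)
      have e2 := H.ne k (k + 1) (a := a) (b := p (k + 2)) (by omega)
      have e3 := ht a
      have := H.increasing hx.left hx.right hx' (x := x) (y := a) (by omega) (by omega) (by omega)
        (by omega)
      omega
    by_cases hq : Z (k + 1) (p k) < Z (k + 1) c
    · have := H.increasing (x := c) (y := x) hq (hc.trans hx.right) (by omega) hx.left hx.right hx'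
        hc
      omega
    · by_cases hqc : c = p k
      · have := H.lt_of_lt hx.left
        rw [hqc] at hac
        omega
      · have := H.ne (k + 1) (k + 1) (a := c) (b := p k) fun h => hqc (H.inj _ h)
        exact hE ⟨c, by omega, by omega, by omega⟩

variable (X Y p) in
/-- The points that are drawn on a given piece of the figure. -/
def OnPiece {m : ℕ} (x : α) : Piece m → Prop
  | .isolated i => x = p i
  | .segment t 0 => Cell X Y p t x ∧ Z t x < Z t (p (t + 2)) ∧ ¬ Early X Y p t x
  | .segment t 1 => Cell X Y p t x ∧ Z t (p (t + 2)) < Z t x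
  | .segment t 2 => Cell X Y p (t + 1) x ∧ Z (t + 1) x < Z (t + 1) (p (t + 3)) ∧
      Early X Y p (t + 1) x

theorem exists_piece {m : ℕ} (H : Chain X Y p (m + 1))
    (hI : ∀ x, Z 1 x < Z 1 (p 0) → x = p 1)
    (hF : ∀ x, Z (m + 2) (p (m + 2)) < Z (m + 2) x → x = p (m + 1)) (x : α) :
    ∃ P : Piece m, OnPiece X Y p x P := by
  by_cases hp : ∃ i : Fin (m + 3), x = p i
  · obtain ⟨i, hi⟩ := hp
    exact ⟨.isolated i, hi⟩
  have hne : ∀ i < m + 3, x ≠ p i := fun i hi h => hp ⟨⟨i, hi⟩, h⟩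
  have hne' : ∀ i < m + 3, ∀ j, Z j x ≠ Z j (p i) := fun i hi j h => hne i hi (H.inj _ h)
  have hex : ∃ t, t ≤ m ∧ Z t x < Z t (p (t + 1)) :=
    ⟨m, le_rfl, lt_of_le_of_ne (H.top x).2 (hne' _ (by omega) _)⟩
  classical
  -- The first index at which `x` falls short of the next isolated point; failure at the preceding
  -- index gives the other wall of the cell.
  obtain ⟨t, ⟨htm, ht⟩, hmin⟩ : ∃ t, (t ≤ m ∧ Z t x < Z t (p (t + 1))) ∧
      ∀ s < t, ¬ (s ≤ m ∧ Z s x < Z s (p (s + 1))) :=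
    ⟨Nat.find hex, Nat.find_spec hex, fun s => Nat.find_min hex⟩
  have hcell : Cell X Y p t x := by
    refine ⟨?_, lt_of_le_of_ne (H.max' t x ht) (hne' _ (by omega) _), ht⟩
    refine lt_of_le_of_ne ?_ (hne' _ (by omega) _).symm
    cases t with
    | zero =>
      by_contra h
      exact hne 1 (by omega) (hI x (not_le.1 h))
    | succ s =>
      by_contra h
      exact hmin s (by omega) ⟨by omega, not_le.1 h⟩
  rcases lt_or_gt_of_ne (hne' (t + 2) (by omega) t) with h | h
  · by_cases hE : Early X Y p t x
    · cases t with
      | zero => exact absurd hE (H.not_early_zero hI)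
      | succ s => exact ⟨.segment ⟨s, by omega⟩ 2, hcell, h, hE⟩
    · rcases htm.lt_or_eq with h' | rfl
      · exact ⟨.segment ⟨t, h'⟩ 0, hcell, h, hE⟩
      · exact absurd (H.early_last hF hcell h) hE
  · rcases htm.lt_or_eq with h' | rfl
    · exact ⟨.segment ⟨t, h'⟩ 1, hcell, h⟩
    · exact absurd (hF x h) (hne _ (by omega))

/-! ### The order of the places in the figure -/

variable (X Y p) in
/-- `Loc X Y p m h x c`: in the coordinate `coord X Y h`, the point `x` has the place `c` in the
figure, and belongs to the `h`-th group of places. -/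
inductive Loc (m : ℕ) : ℕ → α → ℤ → Prop
  | low (h : ℕ) (hm : h ≤ m + 2) : Loc m h (p h) (4 * h - 6)
  | high (h : ℕ) (hm : h ≤ m + 2) : Loc m (h + 1) (p h) (4 * h)
  | middle (t : ℕ) (x : α) (hm : t < m) (hc : Cell X Y p t x) (h : Z t (p (t + 2)) < Z t x) :
      Loc m (t + 2) x (4 * t + 3)
  | late (t : ℕ) (x : α) (hm : t < m) (hc : Cell X Y p t x) (h : Z t x < Z t (p (t + 2)))
      (hE : ¬ Early X Y p t x) : Loc m (t + 2) x (4 * t + 1)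
  | early (t : ℕ) (x : α) (hm : t < m + 1) (hc : Cell X Y p t x) (h : Z t x < Z t (p (t + 2)))
      (hE : Early X Y p t x) : Loc m (t + 2) x (4 * t - 1)
  | late' (t : ℕ) (x : α) (hm : t < m) (hc : Cell X Y p t x)
      (h : Z t (p (t + 2)) < Z t x ∨ ¬ Early X Y p t x) : Loc m (t + 3) x (4 * t + 3)
  | early' (t : ℕ) (x : α) (hm : t < m + 1) (hc : Cell X Y p t x) (h : Z t x < Z t (p (t + 2)))
      (hE : Early X Y p t x) : Loc m (t + 3) x (4 * t + 1)

/-- The windows of groups of equal parity tile the line, so a smaller place means the same group or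
an earlier one. -/
theorem Loc.range {m h : ℕ} {x : α} {c : ℤ} (L : Loc X Y p m h x c) :
    4 * (h : ℤ) - 12 < c ∧ c ≤ 4 * h - 4 := by
  cases L <;> push_cast <;> omega

/-- With `Loc.lt`, this makes `p (h - 1)` the separator of groups `h` and `h + 2`. For `h = 0`
truncated subtraction gives `p 0`, the only member of group 0. -/
theorem Loc.le {m h : ℕ} (H : Chain X Y p (m + 1)) {x : α} {c : ℤ} (L : Loc X Y p m h x c) :
    Z h x ≤ Z h (p (h - 1)) := by
  cases L with
  | low _ hm =>
    cases h with
    | zero => exact le_rfl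
    | succ h => exact (H.lt h).le
  | high h hm => exact le_rfl
  | middle t x hm hc h => exact hc.below.le
  | late t x hm hc h hE => exact hc.below.le
  | early t x hm hc h hE => exact hc.below.le
  | late' t x hm hc h => exact hc.right.le
  | early' t x hm hc h hE => exact hc.right.le

theorem Loc.lt {m h : ℕ} (H : Chain X Y p (m + 1)) {x : α} {c : ℤ}
    (L : Loc X Y p m (h + 2) x c) : Z h (p (h - 1)) < Z h x := by
  have hcell : ∀ {t x}, Cell X Y p t x → Z t (p (t - 1)) < Z t x := by
    intro t x hx
    cases t with
    | zero => exact hx.lower_zero H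
    | succ t => exact hx.lower H
  cases L with
  | low _ hm =>
    cases h with
    | zero => exact H.self_lt_add_two (by omega)
    | succ h => exact H.lt_add_three (by omega)
  | high h hm =>
    cases h with
    | zero => exact H.self_lt_succ 0
    | succ h => exact H.lt_add_two (by omega)
  | middle t x hm hc h => exact hcell hc
  | late t x hm hc h hE => exact hcell hc
  | early t x hm hc h hE => exact hcell hc
  | late' t x hm hc h => exact hc.left
  | early' t x hm hc h hE => exact hc.left

theorem Loc.lt_of_lt_same {m h : ℕ} (H : Chain X Y p (m + 1)) {x y : α} {c d : ℤ}
    (L : Loc X Y p m h x c) (L' : Loc X Y p m h y d) (hcd : c < d) : Z h x < Z h y := by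
  have hup : ∀ {t : ℕ} {x : α}, Cell X Y p (t + 1) x → Z t (p (t + 2)) < Z t x :=
    fun {t x} hx => (H.lt' t).trans hx.left
  cases L <;> cases L' <;> push_cast at hcd <;> first | (exfalso; omega) | skip
  case low.high t _ _ => exact H.lt t
  case low.middle hc h => exact h
  case middle.high hc h _ => exact hc.below
  case late.low hc h hE _ => exact h
  case late.high hc h hE _ => exact hc.below
  case late.middle h hE _ hc' h' => exact h.trans h'
  case early.low hc h hE _ => exact h
  case early.high hc h hE _ => exact hc.below
  case early.middle h hE _ hc' h' => exact h.trans h'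
  case early.late h hE _ hc' h' hE' => exact hE.lt_of_not_early hE'
  case late'.low hc h hm => exact hc.lt_add_three H (by omega)
  case late'.high hc h _ => exact hc.right
  case late'.middle hc h hm hc' h' => exact (hc.lt_add_three H (by omega)).trans h'
  case late'.late hc h hm hc' h' hE' => exact hc.lt_of_not_early H (by omega) hc' hE'
  case early'.low hc h hE hm => exact hc.lt_add_three H (by omega)
  case early'.high hc h hE _ => exact hc.right
  case early'.middle hc h hE hm hc' h' => exact (hc.lt_add_three H (by omega)).trans h'
  case early'.late hc h hE hm hc' h' hE' => exact hc.lt_of_not_early H (by omega) hc' hE'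
  case early'.early hc h hE hm hc' h' hE' =>
    have := Early.lt_of_cut H hc h hE (hc'.lower H) (hup hc')
    exact this
  case early'.late' hc h hE hm hc' h' =>
    rcases h' with h' | h'
    · have := Early.lt_of_cut H hc h hE hc'.left h'
      exact this
    · have := Early.lt_of_not_early' H hc h hE hc' h'
      exact this

theorem _root_.SchubertSimple.coord_congr {h g : ℕ} (hg : h % 2 = g % 2) : Z h = Z g := by
  have key : ∀ g, Z (g % 2) = Z g := by
    intro g
    induction g using Nat.strong_induction_on with
    | _ g ih =>
      match g with
      | 0 => rfl
      | 1 => rfl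
      | g + 2 => rw [Nat.add_mod_right, ih g (by omega)]; rfl
  rw [← key h, hg, key g]

theorem le_add_two_mul (H : Chain X Y p k) (h j : ℕ) :
    Z h (p (h - 1)) ≤ Z h (p (h + 2 * j - 1)) := by
  induction j with
  | zero => exact le_rfl
  | succ j ih =>
    refine ih.trans ?_
    have hstep : ∀ g, Z g (p (g - 1)) ≤ Z g (p (g + 1)) := by
      intro g
      cases g with
      | zero => exact (H.self_lt_succ 0).le
      | succ g => exact H.le_add_two g
    have := hstep (h + 2 * j)
    rwa [coord_congr (show (h + 2 * j) % 2 = h % 2 by omega),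
      show h + 2 * j + 1 = h + 2 * (j + 1) - 1 by omega] at this

theorem Loc.lt_of_lt {m h g : ℕ} (H : Chain X Y p (m + 1)) {x y : α} {c d : ℤ}
    (L : Loc X Y p m h x c) (L' : Loc X Y p m g y d) (hg : h % 2 = g % 2) (hcd : c < d) :
    Z h x < Z h y := by
  have h1 := L.range
  have h2 := L'.range
  obtain ⟨j, rfl⟩ : ∃ j, g = h + 2 * j := ⟨(g - h) / 2, by omega⟩
  cases j with
  | zero => exact L.lt_of_lt_same H L' hcd
  | succ j =>
    have h3 := Loc.lt (h := h + 2 * j) H L'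
    rw [coord_congr (show (h + 2 * j) % 2 = h % 2 by omega)] at h3
    exact (L.le H).trans_lt ((H.le_add_two_mul h j).trans_lt h3)

theorem Loc.cast {m h : ℕ} {x : α} {c d : ℤ} (L : Loc X Y p m h x c) (hcd : c = d) :
    Loc X Y p m h x d := hcd ▸ L

/-- Rows shifted by 2 follow the numbering of the columns with parities exchanged, so `Loc` handles
both. -/
theorem OnPiece.loc {m : ℕ} {x : α} {P : Piece m} (hP : OnPiece X Y p x P) :
    (∃ h, h % 2 = 0 ∧ Loc X Y p m h x P.col) ∧ ∃ h, h % 2 = 1 ∧ Loc X Y p m h x (P.row + 2) := by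
  rcases P with i | ⟨t, s⟩
  · obtain rfl : x = p i := hP
    by_cases hi : Even i.val
    · have hi' := Nat.even_iff.1 hi
      exact ⟨⟨i, hi', (Loc.low _ (by omega)).cast (by simp [Piece.col, hi])⟩,
        ⟨i + 1, by omega, (Loc.high _ (by omega)).cast (by simp [Piece.row, hi])⟩⟩
    · have hi' := Nat.not_even_iff.1 hi
      exact ⟨⟨i + 1, by omega, (Loc.high _ (by omega)).cast (by simp [Piece.col, hi])⟩,
        ⟨i, hi', (Loc.low _ (by omega)).cast (by simp [Piece.row, hi]; ring)⟩⟩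
  · have key : (∃ h, h % 2 = t.val % 2 ∧ Loc X Y p m h x (4 * t.val + 1 + 2 * (s : ℤ))) ∧
        ∃ h, h % 2 ≠ t.val % 2 ∧ Loc X Y p m h x (4 * t.val + 3) := by
      match s, hP with
      | 0, hP => exact ⟨⟨t.val + 2, by omega, (Loc.late _ _ t.2 hP.1 hP.2.1 hP.2.2).cast (by simp)⟩,
          ⟨t.val + 3, by omega, Loc.late' _ _ t.2 hP.1 (Or.inr hP.2.2)⟩⟩
      | 1, hP => exact ⟨⟨t.val + 2, by omega, (Loc.middle _ _ t.2 hP.1 hP.2).cast (by simp; ring)⟩,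
          ⟨t.val + 3, by omega, Loc.late' _ _ t.2 hP.1 (Or.inl hP.2)⟩⟩
      | 2, hP => exact ⟨⟨t.val + 4, by omega,
            (Loc.early' (t.val + 1) _ (by omega) hP.1 hP.2.1 hP.2.2).cast (by simp; ring)⟩,
          ⟨t.val + 3, by omega,
            (Loc.early (t.val + 1) _ (by omega) hP.1 hP.2.1 hP.2.2).cast (by push_cast; ring)⟩⟩
    obtain ⟨⟨h, hh, L⟩, g, hg, L'⟩ := key
    by_cases ht : Even t.val
    · have ht' := Nat.even_iff.1 ht
      exact ⟨⟨h, by omega, L.cast (by simp [Piece.col, ht])⟩,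
        ⟨g, by omega, L'.cast (by simp [Piece.row, ht]; ring)⟩⟩
    · have ht' := Nat.not_even_iff.1 ht
      exact ⟨⟨g, by omega, L'.cast (by simp [Piece.col, ht])⟩,
        ⟨h, by omega, L.cast (by simp [Piece.row, ht]; ring)⟩⟩

theorem OnPiece.col_lt {m : ℕ} (H : Chain X Y p (m + 1)) {x y : α} {P Q : Piece m}
    (hP : OnPiece X Y p x P) (hQ : OnPiece X Y p y Q) (h : P.col < Q.col) : X x < X y := by
  obtain ⟨i, hi, L⟩ := hP.loc.1
  obtain ⟨j, hj, L'⟩ := hQ.loc.1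
  have := L.lt_of_lt H L' (by omega) h
  rwa [coord_congr (show i % 2 = 0 % 2 by omega)] at this

theorem OnPiece.row_lt {m : ℕ} (H : Chain X Y p (m + 1)) {x y : α} {P Q : Piece m}
    (hP : OnPiece X Y p x P) (hQ : OnPiece X Y p y Q) (h : P.row < Q.row) : Y x < Y y := by
  obtain ⟨i, hi, L⟩ := hP.loc.2
  obtain ⟨j, hj, L'⟩ := hQ.loc.2
  have := L.lt_of_lt H L' (by omega) (by omega)
  rwa [coord_congr (show i % 2 = 1 % 2 by omega)] at this

theorem _root_.SchubertSimple.Piece.ext_of_col_row {m : ℕ} {P Q : Piece m} (hc : P.col = Q.col)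
    (hr : P.row = Q.row) : P = Q := by
  rcases P with i | ⟨t, s⟩ <;> rcases Q with j | ⟨u, v⟩ <;>
    simp only [Piece.col, Piece.row, Nat.even_iff, Piece.isolated.injEq, Piece.segment.injEq,
      reduceCtorEq, Fin.ext_iff] at hc hr ⊢ <;> split_ifs at hc hr <;> omega

theorem OnPiece.unique {m : ℕ} (H : Chain X Y p (m + 1)) {x : α} {P Q : Piece m}
    (hP : OnPiece X Y p x P) (hQ : OnPiece X Y p x Q) : P = Q := by
  refine Piece.ext_of_col_row ?_ ?_
  · rcases lt_trichotomy P.col Q.col with h | h | h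
    · exact absurd (OnPiece.col_lt H hP hQ h) (lt_irrefl _)
    · exact h
    · exact absurd (OnPiece.col_lt H hQ hP h) (lt_irrefl _)
  · rcases lt_trichotomy P.row Q.row with h | h | h
    · exact absurd (OnPiece.row_lt H hP hQ h) (lt_irrefl _)
    · exact h
    · exact absurd (OnPiece.row_lt H hQ hP h) (lt_irrefl _)

theorem _root_.SchubertSimple.coord_cases (t : ℕ) : Z t = X ∧ Z (t + 1) = Y ∨ Z t = Y ∧ Z (t + 1) = X := by
  rcases Nat.mod_two_eq_zero_or_one t with h | h
  · exact Or.inl ⟨coord_congr (g := 0) h, coord_congr (g := 1) (by omega)⟩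
  · exact Or.inr ⟨coord_congr (g := 1) h, coord_congr (g := 0) (by omega)⟩

theorem Cell.increasing (H : Chain X Y p k) {t : ℕ} {x y : α} (hx : Cell X Y p t x)
    (hx' : Z t x < Z t (p (t + 2))) (hy : Cell X Y p t y) (hy' : Z t y < Z t (p (t + 2)))
    (hxy : X x < X y) : Y x < Y y := by
  have h1 := H.increasing hx.left hx.right hx' hy.left hy.right hy'
  have h2 := H.increasing hy.left hy.right hy' hx.left hx.right hx'
  have h3 := H.ne 0 1 (a := x) (b := y) hxy.ne
  change Y x ≠ Y y at h3
  rcases coord_cases (X := X) (Y := Y) t with ⟨h, h'⟩ | ⟨h, h'⟩ <;> rw [h, h'] at h1 h2 <;> omega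

theorem Cell.decreasing (H : Chain X Y p k) {t : ℕ} {x y : α} (hx : Cell X Y p t x)
    (hx' : Z t (p (t + 2)) < Z t x) (hy : Cell X Y p t y) (hy' : Z t (p (t + 2)) < Z t y)
    (hxy : X x < X y) : Y y < Y x := by
  -- A rise from `x` to `y` would complete 4231 with `p (t + 1)` and `p (t + 2)`.
  have key : ∀ {x y : α}, Cell X Y p t x → Z t (p (t + 2)) < Z t x → Cell X Y p t y →
      Z (t + 1) x < Z (t + 1) y → ¬ Z t x < Z t y := fun {x y} hx hx' hy h h' =>
    (H.plane.coord (t + 1)).av4231 (p (t + 1)) x y (p (t + 2)) ((H.lt t).trans hx.left) h hy.right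
      hx' h' hy.below
  have h1 := key hx hx' hy
  have h2 := key hy hy' hx
  have h3 := H.ne 0 1 (a := x) (b := y) hxy.ne
  change Y x ≠ Y y at h3
  rcases coord_cases (X := X) (Y := Y) t with ⟨h, h'⟩ | ⟨h, h'⟩ <;> rw [h, h'] at h1 h2 <;> omega

end Chain
-- The converse: a finite check on a window of the figure
/-- The places of four consecutive blocks of the figure, translated. -/
def places : List (ℕ × ℕ) :=
  [(9, 9), (10, 14), (11, 9), (12, 4), (13, 9), (15, 11), (15, 13), (15, 15), (17, 17), (18,
   22), (19, 17), (20, 12), (21, 17), (23, 19), (23, 21), (23, 23), (25, 25), (26, 30), (27,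
   25), (28, 20), (29, 25), (31, 27), (31, 29), (31, 31), (33, 33), (34, 38), (35, 33), (36,
   28), (37, 33), (39, 35), (39, 37), (39, 39)]

/-- A point at `y` may be to the right of and above a point at `x`. -/
def risesTo (x y : ℕ × ℕ) : Bool :=
  Nat.ble x.1 y.1 && (Nat.ble x.2 y.2 &&
    (!(Nat.beq x.1 y.1 && Nat.beq x.2 y.2) || (Nat.beq x.1 x.2 || Nat.beq x.1 (x.2 + 4))))

/-- A point at `y` may be to the right of and below a point at `x`. -/
def fallsTo (x y : ℕ × ℕ) : Bool :=
  Nat.ble x.1 y.1 && (Nat.ble y.2 x.2 &&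
    (!(Nat.beq x.1 y.1 && Nat.beq x.2 y.2) || Nat.beq x.1 (x.2 + 2)))

set_option synthInstance.maxSize 1000 in
theorem mem_places : ∀ c ∈ List.range 40, 8 ≤ c → (c % 8 = 2 → (c, c + 4) ∈ places) ∧
    (c % 8 = 4 → (c, c - 8) ∈ places) ∧ (c % 8 = 1 → (c, c) ∈ places) ∧
    (c % 8 = 3 → (c, c - 2) ∈ places) ∧ (c % 8 = 5 → (c, c - 4) ∈ places) ∧
    (c % 8 = 7 → (c, c - 4) ∈ places ∧ (c, c - 2) ∈ places ∧ (c, c) ∈ places) := by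
  decide +kernel

/-- The first point is confined to the first period of 8 columns. Each relation is tested as soon as
its points are chosen, and an inversion from `a` comes first, which keeps the enumeration small. -/
theorem places_av4231 : ∀ a ∈ places, a.1 < 16 → ∀ d ∈ places, fallsTo a d →
    ∀ b ∈ places, fallsTo a b → fallsTo b d →
    ∀ c ∈ places, fallsTo a c → risesTo b c → fallsTo c d → False := by
  decide +kernel

theorem places_av35142 : ∀ a ∈ places, a.1 < 16 → ∀ e ∈ places, fallsTo a e →
    ∀ c ∈ places, fallsTo a c → risesTo c e →
    ∀ d ∈ places, risesTo a d → risesTo c d → fallsTo d e →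
    ∀ b ∈ places, risesTo a b → fallsTo b c → fallsTo b d → fallsTo b e → False := by
  decide +kernel

theorem places_av42513 : ∀ a ∈ places, a.1 < 16 → ∀ e ∈ places, fallsTo a e →
    ∀ b ∈ places, fallsTo a b → risesTo b e →
    ∀ d ∈ places, fallsTo a d → fallsTo b d → risesTo d e →
    ∀ c ∈ places, risesTo a c → risesTo b c → fallsTo c d → fallsTo c e → False := by
  decide +kernel

theorem places_av351624 : ∀ a ∈ places, a.1 < 16 → ∀ e ∈ places, fallsTo a e →
    ∀ c ∈ places, fallsTo a c → risesTo c e →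
    ∀ b ∈ places, risesTo a b → fallsTo b c → fallsTo b e →
    ∀ d ∈ places, risesTo a d → risesTo b d → risesTo c d → fallsTo d e →
    ∀ f ∈ places, risesTo a f → fallsTo b f → risesTo c f → fallsTo d f → risesTo e f → False := by
  decide +kernel

namespace Piece

variable {m : ℕ}

theorem shape (P : Piece m) : P.col % 8 = 2 ∧ P.row = P.col + 4 ∨
    P.col % 8 = 4 ∧ P.row = P.col - 8 ∨ P.col % 8 = 1 ∧ P.row = P.col ∨
    P.col % 8 = 3 ∧ P.row = P.col - 2 ∨ P.col % 8 = 5 ∧ P.row = P.col - 4 ∨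
    P.col % 8 = 7 ∧ (P.row = P.col - 4 ∨ P.row = P.col - 2 ∨ P.row = P.col) := by
  rcases P with i | ⟨t, s⟩ <;> simp only [Piece.col, Piece.row, Nat.even_iff] <;> split_ifs <;>
    omega

/-- The place of a piece relative to the pair of blocks numbered `2 * k` and `2 * k + 1`. -/
def place (k : ℤ) (P : Piece m) : ℕ × ℕ :=
  -- The summand 8 prevents truncation in the row, which can be 8 below the column.
  ((P.col - 8 * k + 8).toNat, (P.row - 8 * k + 8).toNat)

theorem place_mem {k : ℤ} {P : Piece m} (h : 8 * k ≤ P.col) (h' : P.col < 8 * k + 32) :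
    P.place k ∈ places := by
  have hs := P.shape
  unfold place
  obtain ⟨c, hc⟩ : ∃ c : ℕ, P.col - 8 * k + 8 = c := ⟨_, (Int.toNat_of_nonneg (by omega)).symm⟩
  obtain ⟨m2, m4, m1, m3, m5, m7⟩ := mem_places c (List.mem_range.2 (by omega)) (by omega)
  have key : ∀ d : ℕ, (c, d) ∈ places → P.row - 8 * k + 8 = d →
      ((P.col - 8 * k + 8).toNat, (P.row - 8 * k + 8).toNat) ∈ places := by
    intro d hd hd'
    rwa [hc, hd', Int.toNat_natCast, Int.toNat_natCast]
  rcases hs with ⟨h1, h2⟩ | ⟨h1, h2⟩ | ⟨h1, h2⟩ | ⟨h1, h2⟩ | ⟨h1, h2⟩ | ⟨h1, h2 | h2 | h2⟩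
  · exact key _ (m2 (by omega)) (by omega)
  · exact key _ (m4 (by omega)) (by omega)
  · exact key _ (m1 (by omega)) (by omega)
  · exact key _ (m3 (by omega)) (by omega)
  · exact key _ (m5 (by omega)) (by omega)
  · exact key _ (m7 (by omega)).1 (by omega)
  · exact key _ (m7 (by omega)).2.1 (by omega)
  · exact key _ (m7 (by omega)).2.2 (by omega)

/-- The places of two points of a drawing, the second to the right of and above the first. -/
def RisesTo (P Q : Piece m) : Prop :=
  P.col ≤ Q.col ∧ P.row ≤ Q.row ∧ (P.col = Q.col → P.row = Q.row →
    P.col = P.row ∨ P.col = P.row + 4)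

/-- The places of two points of a drawing, the second to the right of and below the first. -/
def FallsTo (P Q : Piece m) : Prop :=
  P.col ≤ Q.col ∧ Q.row ≤ P.row ∧ (P.col = Q.col → P.row = Q.row → P.col = P.row + 2)

/-- A row exceeds its column by at most 4 and falls short of it by at most 8. -/
theorem FallsTo.col_le {P Q : Piece m} (h : FallsTo P Q) : Q.col ≤ P.col + 12 := by
  have h1 := P.shape
  have h2 := Q.shape
  have h3 := h.2.1
  omega

theorem RisesTo.place {P Q : Piece m} (h : RisesTo P Q) {k : ℤ} (hP : 8 * k ≤ P.col)
    (hQ : 8 * k ≤ Q.col) : risesTo (P.place k) (Q.place k) := by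
  have h1 := P.shape
  have h2 := Q.shape
  obtain ⟨h3, h4, h5⟩ := h
  simp only [risesTo, Piece.place, Bool.and_eq_true, Bool.or_eq_true, Bool.not_eq_true',
    Nat.ble_eq, Nat.beq_eq, ← Bool.not_eq_true]
  omega

theorem FallsTo.place {P Q : Piece m} (h : FallsTo P Q) {k : ℤ} (hP : 8 * k ≤ P.col)
    (hQ : 8 * k ≤ Q.col) : fallsTo (P.place k) (Q.place k) := by
  have h1 := P.shape
  have h2 := Q.shape
  obtain ⟨h3, h4, h5⟩ := h
  simp only [fallsTo, Piece.place, Bool.and_eq_true, Bool.or_eq_true, Bool.not_eq_true',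
    Nat.ble_eq, Nat.beq_eq, ← Bool.not_eq_true]
  omega

theorem exists_base (P : Piece m) : ∃ k : ℤ, 8 * k ≤ P.col ∧ P.col < 8 * k + 8 ∧
    (P.place k).1 < 16 := by
  refine ⟨P.col / 8, by omega, by omega, ?_⟩
  simp only [place]
  omega

end Piece

namespace IsDrawing

variable {n m : ℕ} {π : Equiv.Perm (Fin n)} {piece : Fin n → Piece m}

theorem eq_of_isolated (D : IsDrawing π piece) {x y : Fin n} {i : Fin (m + 3)}
    (hx : piece x = .isolated i) (hy : piece y = .isolated i) : x = y :=
  (D.isolated_present i).unique hx hy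

theorem risesTo (D : IsDrawing π piece) {x y : Fin n} (h : x < y) (h' : π x < π y) :
    (piece x).RisesTo (piece y) := by
  refine ⟨D.col_le x y h, D.row_le x y h', fun hc hr => ?_⟩
  have he := Piece.ext_of_col_row hc hr
  rcases hx : piece x with i | ⟨t, s⟩
  · rw [D.eq_of_isolated hx (he ▸ hx)] at h
    exact absurd h (lt_irrefl _)
  · have hs : s ≠ 1 := by
      rintro rfl
      exact absurd (D.decreasing t x y hx (he ▸ hx) h) h'.asymm
    simp only [Piece.col, Piece.row]
    split_ifs <;> omega

theorem fallsTo (D : IsDrawing π piece) {x y : Fin n} (h : x < y) (h' : π y < π x) :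
    (piece x).FallsTo (piece y) := by
  refine ⟨D.col_le x y h, D.row_le y x h', fun hc hr => ?_⟩
  have he := Piece.ext_of_col_row hc hr
  rcases hx : piece x with i | ⟨t, s⟩
  · rw [D.eq_of_isolated hx (he ▸ hx)] at h
    exact absurd h (lt_irrefl _)
  · have hs : s = 1 := by
      by_contra hs
      exact absurd (D.increasing t s hs x y hx (he ▸ hx) h) h'.asymm
    subst hs
    simp only [Piece.col, Piece.row]
    split_ifs <;> (norm_num; try ring)

/-- Every permutation that can be drawn on the figure lies in the class. -/
theorem inClassA (D : IsDrawing π piece) : InClassA π := by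
  refine ⟨?_, ?_, ?_, ?_⟩
  · rintro ⟨f, hf, hw⟩
    have up : ∀ i j, i < j → ![4, 2, 3, 1] i < ![4, 2, 3, 1] j →
      (piece (f i)).RisesTo (piece (f j)) := fun i j h h' => D.risesTo (hf h) ((hw i j).1 h')
    have dn : ∀ i j, i < j → ![4, 2, 3, 1] j < ![4, 2, 3, 1] i →
      (piece (f i)).FallsTo (piece (f j)) := fun i j h h' => D.fallsTo (hf h) ((hw j i).1 h')
    have ab := dn 0 1 (by decide) (by decide)
    have ac := dn 0 2 (by decide) (by decide)
    have ad := dn 0 3 (by decide) (by decide)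
    have bc := up 1 2 (by decide) (by decide)
    have bd := dn 1 3 (by decide) (by decide)
    have cd := dn 2 3 (by decide) (by decide)
    obtain ⟨k, h1, h2, h3⟩ := (piece (f 0)).exists_base
    have cad := ad.col_le
    have c1 := ab.1
    have c2 := bc.1
    have c3 := cd.1
    exact places_av4231 _ (Piece.place_mem h1 (by omega)) h3
      _ (Piece.place_mem (by omega) (by omega)) (ad.place (by omega) (by omega))
      _ (Piece.place_mem (by omega) (by omega)) (ab.place (by omega) (by omega))
      (bd.place (by omega) (by omega))
      _ (Piece.place_mem (by omega) (by omega)) (ac.place (by omega) (by omega))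
      (bc.place (by omega) (by omega)) (cd.place (by omega) (by omega))
  · rintro ⟨f, hf, hw⟩
    have up : ∀ i j, i < j → ![3, 5, 1, 4, 2] i < ![3, 5, 1, 4, 2] j →
      (piece (f i)).RisesTo (piece (f j)) := fun i j h h' => D.risesTo (hf h) ((hw i j).1 h')
    have dn : ∀ i j, i < j → ![3, 5, 1, 4, 2] j < ![3, 5, 1, 4, 2] i →
      (piece (f i)).FallsTo (piece (f j)) := fun i j h h' => D.fallsTo (hf h) ((hw j i).1 h')
    have ab := up 0 1 (by decide) (by decide)
    have ac := dn 0 2 (by decide) (by decide)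
    have ad := up 0 3 (by decide) (by decide)
    have ae := dn 0 4 (by decide) (by decide)
    have bc := dn 1 2 (by decide) (by decide)
    have bd := dn 1 3 (by decide) (by decide)
    have be := dn 1 4 (by decide) (by decide)
    have cd := up 2 3 (by decide) (by decide)
    have ce := up 2 4 (by decide) (by decide)
    have de := dn 3 4 (by decide) (by decide)
    obtain ⟨k, h1, h2, h3⟩ := (piece (f 0)).exists_base
    have c0 := ae.col_le
    have c1 := ab.1
    have c2 := bc.1
    have c3 := cd.1
    have c4 := de.1
    exact places_av35142 _ (Piece.place_mem h1 (by omega)) h3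
      _ (Piece.place_mem (by omega) (by omega))
      (ae.place (by omega) (by omega))
      _ (Piece.place_mem (by omega) (by omega))
      (ac.place (by omega) (by omega))
      (ce.place (by omega) (by omega))
      _ (Piece.place_mem (by omega) (by omega))
      (ad.place (by omega) (by omega))
      (cd.place (by omega) (by omega))
      (de.place (by omega) (by omega))
      _ (Piece.place_mem (by omega) (by omega))
      (ab.place (by omega) (by omega))
      (bc.place (by omega) (by omega))
      (bd.place (by omega) (by omega))
      (be.place (by omega) (by omega))
  · rintro ⟨f, hf, hw⟩
    have up : ∀ i j, i < j → ![4, 2, 5, 1, 3] i < ![4, 2, 5, 1, 3] j →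
      (piece (f i)).RisesTo (piece (f j)) := fun i j h h' => D.risesTo (hf h) ((hw i j).1 h')
    have dn : ∀ i j, i < j → ![4, 2, 5, 1, 3] j < ![4, 2, 5, 1, 3] i →
      (piece (f i)).FallsTo (piece (f j)) := fun i j h h' => D.fallsTo (hf h) ((hw j i).1 h')
    have ab := dn 0 1 (by decide) (by decide)
    have ac := up 0 2 (by decide) (by decide)
    have ad := dn 0 3 (by decide) (by decide)
    have ae := dn 0 4 (by decide) (by decide)
    have bc := up 1 2 (by decide) (by decide)
    have bd := dn 1 3 (by decide) (by decide)
    have be := up 1 4 (by decide) (by decide)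
    have cd := dn 2 3 (by decide) (by decide)
    have ce := dn 2 4 (by decide) (by decide)
    have de := up 3 4 (by decide) (by decide)
    obtain ⟨k, h1, h2, h3⟩ := (piece (f 0)).exists_base
    have c0 := ae.col_le
    have c1 := ab.1
    have c2 := bc.1
    have c3 := cd.1
    have c4 := de.1
    exact places_av42513 _ (Piece.place_mem h1 (by omega)) h3
      _ (Piece.place_mem (by omega) (by omega))
      (ae.place (by omega) (by omega))
      _ (Piece.place_mem (by omega) (by omega))
      (ab.place (by omega) (by omega))
      (be.place (by omega) (by omega))
      _ (Piece.place_mem (by omega) (by omega))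
      (ad.place (by omega) (by omega))
      (bd.place (by omega) (by omega))
      (de.place (by omega) (by omega))
      _ (Piece.place_mem (by omega) (by omega))
      (ac.place (by omega) (by omega))
      (bc.place (by omega) (by omega))
      (cd.place (by omega) (by omega))
      (ce.place (by omega) (by omega))
  · rintro ⟨f, hf, hw⟩
    have up : ∀ i j, i < j → ![3, 5, 1, 6, 2, 4] i < ![3, 5, 1, 6, 2, 4] j →
      (piece (f i)).RisesTo (piece (f j)) := fun i j h h' => D.risesTo (hf h) ((hw i j).1 h')
    have dn : ∀ i j, i < j → ![3, 5, 1, 6, 2, 4] j < ![3, 5, 1, 6, 2, 4] i →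
      (piece (f i)).FallsTo (piece (f j)) := fun i j h h' => D.fallsTo (hf h) ((hw j i).1 h')
    have ab := up 0 1 (by decide) (by decide)
    have ac := dn 0 2 (by decide) (by decide)
    have ad := up 0 3 (by decide) (by decide)
    have ae := dn 0 4 (by decide) (by decide)
    have af := up 0 5 (by decide) (by decide)
    have bc := dn 1 2 (by decide) (by decide)
    have bd := up 1 3 (by decide) (by decide)
    have be := dn 1 4 (by decide) (by decide)
    have bf := dn 1 5 (by decide) (by decide)
    have cd := up 2 3 (by decide) (by decide)
    have ce := up 2 4 (by decide) (by decide)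
    have cf := up 2 5 (by decide) (by decide)
    have de := dn 3 4 (by decide) (by decide)
    have df := dn 3 5 (by decide) (by decide)
    have ef := up 4 5 (by decide) (by decide)
    obtain ⟨k, h1, h2, h3⟩ := (piece (f 0)).exists_base
    have c0 := ae.col_le
    -- Two inversions are needed here: `f` is at most 12 columns after `d`, hence after `e`, and `e`
    -- at most 12 after `a`. The total of 24 just fits the 32 columns of `places`.
    have c0' := df.col_le
    have c1 := ab.1
    have c2 := bc.1
    have c3 := cd.1
    have c4 := de.1
    have c5 := ef.1
    exact places_av351624 _ (Piece.place_mem h1 (by omega)) h3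
      _ (Piece.place_mem (by omega) (by omega))
      (ae.place (by omega) (by omega))
      _ (Piece.place_mem (by omega) (by omega))
      (ac.place (by omega) (by omega))
      (ce.place (by omega) (by omega))
      _ (Piece.place_mem (by omega) (by omega))
      (ab.place (by omega) (by omega))
      (bc.place (by omega) (by omega))
      (be.place (by omega) (by omega))
      _ (Piece.place_mem (by omega) (by omega))
      (ad.place (by omega) (by omega))
      (bd.place (by omega) (by omega))
      (cd.place (by omega) (by omega))
      (de.place (by omega) (by omega))
      _ (Piece.place_mem (by omega) (by omega))
      (af.place (by omega) (by omega))
      (bf.place (by omega) (by omega))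
      (cf.place (by omega) (by omega))
      (df.place (by omega) (by omega))
      (ef.place (by omega) (by omega))

end IsDrawing

/-! ### From permutations to point sets, and conclusion -/

/-- Here `f` lists the entries by position, `g` the same entries by value, and `σ` gives the ranks
of the letters of `w`. -/
theorem contains_of_strictMono {k n : ℕ} {w : Fin k → ℕ} {π : Equiv.Perm (Fin n)}
    {f g : Fin k → Fin n} (σ : Fin k → Fin k) (hf : StrictMono f) (hg : StrictMono fun i => π (g i))
    (hw : ∀ i j, w i < w j ↔ σ i < σ j) (hfg : ∀ i, f i = g (σ i)) : Contains w π :=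
  ⟨f, hf, fun i j => by rw [hw, hfg, hfg]; exact (hg.lt_iff_lt).symm⟩

theorem InClassA.planeSimple {n : ℕ} {π : Equiv.Perm (Fin n)} (hA : InClassA π)
    (hπ : IsSimple π) :
    PlaneSimple (fun x : Fin n => (x.val : ℤ)) (fun x => ((π x).val : ℤ)) where
  injX a b h := Fin.ext (by exact_mod_cast h)
  injY a b h := π.injective (Fin.ext (by exact_mod_cast h))
  simple S hX hY := by
    have key : ∀ {T : Set (Fin n)}, (∀ a ∈ T, ∀ b ∈ T, ∀ c, a < c → c < b → c ∈ T) →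
        T.OrdConnected := by
      refine fun {T} hT => ⟨fun a ha b hb c hc => ?_⟩
      rcases hc.1.eq_or_lt with rfl | h
      · exact ha
      rcases hc.2.eq_or_lt with rfl | h'
      · exact hb
      exact hT a ha b hb c h h'
    refine hπ S (key fun a ha b hb c h h' => hX a ha b hb c (by exact_mod_cast h)
      (by exact_mod_cast h')) (key ?_)
    rintro _ ⟨a, ha, rfl⟩ _ ⟨b, hb, rfl⟩ c h h'
    refine ⟨π.symm c, hY a ha b hb _ ?_ ?_, π.apply_symm_apply c⟩ <;>
      simpa using (by assumption)
  av4231 a b c d h1 h2 h3 g1 g2 g3 := by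
    simp only [Nat.cast_lt, Fin.val_fin_lt] at h1 h2 h3 g1 g2 g3
    exact hA.1 (contains_of_strictMono (f := ![a, b, c, d]) (g := ![d, b, c, a]) ![3, 1, 2, 0]
      (by rw [Fin.strictMono_iff_lt_succ]; intro i; fin_cases i <;> assumption)
      (by rw [Fin.strictMono_iff_lt_succ]; intro i; fin_cases i <;> assumption)
      (by decide) (by intro i; fin_cases i <;> rfl))
  av35142 a b c d e h1 h2 h3 h4 g1 g2 g3 g4 := by
    simp only [Nat.cast_lt, Fin.val_fin_lt] at h1 h2 h3 h4 g1 g2 g3 g4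
    exact hA.2.1 (contains_of_strictMono (f := ![a, b, c, d, e]) (g := ![c, e, a, d, b]) ![2, 4, 0, 3, 1]
      (by rw [Fin.strictMono_iff_lt_succ]; intro i; fin_cases i <;> assumption)
      (by rw [Fin.strictMono_iff_lt_succ]; intro i; fin_cases i <;> assumption)
      (by decide) (by intro i; fin_cases i <;> rfl))
  av42513 a b c d e h1 h2 h3 h4 g1 g2 g3 g4 := by
    simp only [Nat.cast_lt, Fin.val_fin_lt] at h1 h2 h3 h4 g1 g2 g3 g4
    exact hA.2.2.1 (contains_of_strictMono (f := ![a, b, c, d, e]) (g := ![d, b, e, a, c]) ![3, 1, 4, 0, 2]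
      (by rw [Fin.strictMono_iff_lt_succ]; intro i; fin_cases i <;> assumption)
      (by rw [Fin.strictMono_iff_lt_succ]; intro i; fin_cases i <;> assumption)
      (by decide) (by intro i; fin_cases i <;> rfl))
  av351624 a b c d e f h1 h2 h3 h4 h5 g1 g2 g3 g4 g5 := by
    simp only [Nat.cast_lt, Fin.val_fin_lt] at h1 h2 h3 h4 h5 g1 g2 g3 g4 g5
    exact hA.2.2.2 (contains_of_strictMono (f := ![a, b, c, d, e, f]) (g := ![c, e, a, f, b, d]) ![2, 4, 0, 5, 1, 3]
      (by rw [Fin.strictMono_iff_lt_succ]; intro i; fin_cases i <;> assumption)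
      (by rw [Fin.strictMono_iff_lt_succ]; intro i; fin_cases i <;> assumption)
      (by decide) (by intro i; fin_cases i <;> rfl))

theorem hasCrenellationForm {n : ℕ} {π : Equiv.Perm (Fin n)} (hπ : IsSimple π) (n0 : 0 < n) (n1 : 1 < n)
    (n2 : 2 < n) (hA : InClassA π) (h1 : π ⟨1, n1⟩ ≠ ⟨0, n0⟩) : HasCrenellationForm π := by
  have C := hA.planeSimple hπ
  have h3 : ∀ c : Fin n, ∃ a b, a ≠ b ∧ a ≠ c ∧ b ≠ c := by
    intro c
    by_cases hc : c.val = 0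
    · exact ⟨⟨1, n1⟩, ⟨2, n2⟩, by simp, by rw [Ne, Fin.ext_iff]; simp; omega,
        by rw [Ne, Fin.ext_iff]; simp; omega⟩
    by_cases hc' : c.val = 1
    · exact ⟨⟨0, n0⟩, ⟨2, n2⟩, by simp, by rw [Ne, Fin.ext_iff]; simp; omega,
        by rw [Ne, Fin.ext_iff]; simp; omega⟩
    · exact ⟨⟨0, n0⟩, ⟨1, n1⟩, by simp, by rw [Ne, Fin.ext_iff]; simp; omega,
        by rw [Ne, Fin.ext_iff]; simp; omega⟩
  have hleft : ∀ x : Fin n, ((0 : ℕ) : ℤ) ≤ (x.val : ℤ) := fun x => by omega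
  have hbot : ∀ x : Fin n, x ≠ π.symm ⟨0, n0⟩ →
      (((π (π.symm ⟨0, n0⟩)).val : ℕ) : ℤ) < (π x).val := by
    intro x hx
    have : π x ≠ ⟨0, n0⟩ := fun h => hx (by rw [← h, π.symm_apply_apply])
    have : (π x).val ≠ 0 := fun h => this (Fin.ext h)
    rw [π.apply_symm_apply]
    simp only
    omega
  have hb : ((π (π.symm ⟨0, n0⟩)).val : ℤ) < ((π ⟨0, n0⟩).val : ℤ) := by
    refine hbot _ fun h => ?_
    obtain ⟨a, b, hab, ha, hb⟩ := h3 ⟨0, n0⟩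
    refine C.not_corner hab ha hb (Or.inl hleft) (Or.inl fun x => ?_)
    rw [h, π.apply_symm_apply]
    simp
  obtain ⟨k, H⟩ := exists_chain C (a := ⟨0, n0⟩) hleft hb
  have hsec : ∀ e : Fin n, e ≠ ⟨0, n0⟩ →
      (∀ x : Fin n, x ≠ ⟨0, n0⟩ → (e.val : ℤ) ≤ x.val) →
      ∃ x, ((π x).val : ℤ) < (π e).val := by
    intro e he he'
    have h := he' ⟨1, n1⟩ (by simp)
    have he0 : e.val ≠ 0 := fun h => he (Fin.ext h)
    have he1 : e = ⟨1, n1⟩ := Fin.ext (by simp only at h ⊢; omega)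
    exact ⟨_, hbot _ fun h => h1 (by rw [← he1, h, π.apply_symm_apply])⟩
  have hk := H.one_lt h3 hsec
  -- A zigzag `p 0, …, p (k + 1)` has `k + 2 = m + 3` points; `1 < k` is what makes `m` positive.
  obtain ⟨m, rfl⟩ : ∃ m, k = m + 1 := ⟨k - 1, by omega⟩
  choose piece hpiece using
    H.exists_piece (fun x => H.initial (by omega) hsec) (fun x => H.final hk)
  refine ⟨m, by omega, piece, ?_, ?_, ?_, ?_, ?_⟩
  · intro i
    refine ⟨_, (hpiece _).unique H rfl, fun y hy => ?_⟩
    have := hpiece y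
    rw [hy] at this
    exact this
  · intro x y hxy
    by_contra h
    have := (hpiece y).col_lt H (hpiece x) (not_le.1 h)
    simp only [Fin.lt_def] at *
    omega
  · intro x y hxy
    by_contra h
    have := (hpiece y).row_lt H (hpiece x) (not_le.1 h)
    simp only [Fin.lt_def] at *
    omega
  · intro t s hs x y hx hy hxy
    have hx' := hpiece x
    have hy' := hpiece y
    rw [hx] at hx'
    rw [hy] at hy'
    have hxy' : (x.val : ℤ) < y.val := by exact_mod_cast hxy
    have key : ((π x).val : ℤ) < (π y).val := by
      match s, hx', hy' with
      | 0, hx', hy' => exact hx'.1.increasing H hx'.2.1 hy'.1 hy'.2.1 hxy'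
      | 1, _, _ => exact absurd rfl hs
      | 2, hx', hy' => exact hx'.1.increasing H hx'.2.1 hy'.1 hy'.2.1 hxy'
    exact_mod_cast key
  · intro t x y hx hy hxy
    have hx' := hpiece x
    have hy' := hpiece y
    rw [hx] at hx'
    rw [hy] at hy'
    have hxy' : (x.val : ℤ) < y.val := by exact_mod_cast hxy
    have key : ((π y).val : ℤ) < (π x).val := hx'.1.decreasing H hx'.2 hy'.1 hy'.2 hxy'
    exact_mod_cast key

end SchubertSimple

theorem mainTheorem2 {n : ℕ} (π : Equiv.Perm (Fin n)) (hπ : SchubertSimple.IsSimple π) :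
    (∀ hn : 4 ≤ n, SchubertSimple.InClassA π →
      π ⟨1, by omega⟩ ≠ ⟨0, by omega⟩ → SchubertSimple.HasCrenellationForm π) ∧
    (SchubertSimple.HasCrenellationForm π → SchubertSimple.InClassA π) :=
  ⟨fun hn hA h1 => SchubertSimple.hasCrenellationForm hπ _ _ (by omega) hA h1,
    fun ⟨_, _, _, D⟩ => D.inClassA⟩
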